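/- Let $B$ be a compact real (embedded) submanifold of the quaternionic projective space $\mathbb{HP}^n=S^{4n+3}/S^3$ (quotient of the unit sphere of $\mathbb H^{n+1}$ by left multiplication by unit quaternions), and let $\pi:P\to B$ be the principal $S^3$-bundle induced over $B$ by the Hopf bundle $S^{4n+3}\to\mathbb{HP}^n$. Suppose that $B$ carries a Sasakian structure $(\varphi,\xi,\eta,g^B)$, i.e. a normal contact metric structure: $\eta(\xi)=1$, $\varphi^2=-1+\eta\otimes\xi$, $g^B(\varphi X,\varphi Y)=g^B(X,Y)-\eta(X)\eta(Y)$, $d\eta(X,Y)=2g^B(X,\varphi Y)$ and $[\varphi,\varphi]+d\eta\otimes\xi=0$, where $d\theta(X,Y)=X\theta(Y)-Y\theta(X)-\theta([X,Y])$ for one-forms $\theta$ and $[\varphi,\varphi](X,Y)=\varphi^2[X,Y]+[\varphi X,\varphi Y]-\varphi[\varphi X,Y]-\varphi[X,\varphi Y]$. (The structure need not be induced from $\mathbb{HP}^n$.) Let $\mathcal H$ be the connection on $P$ induced from the Hopf bundle, whose horizontal spaces consist of the vectors that are mapped to the Euclidean orthogonal complement of the $S^3$-orbits in $S^{4n+3}$,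 and write $X^*$ for the horizontal lift of $X$. Let $\xi_1,\xi_2,\xi_3$ be the vertical vector fields $x\mapsto -ix,\,-jx,\,-kx$ on $P$. Let $g$ be the metric on $P$ for which $\mathcal H$ is orthogonal to the fibres, $\pi:(P,g)\to(B,g^B)$ is a Riemannian submersion and $\xi_1,\xi_2,\xi_3$ are orthonormal, and let $\hat\eta_i=g(\xi_i,\cdot)$. Let $J$ be the almost complex structure on $P$ defined by $$J\xi_1=\xi_2,\quad J\xi_2=-\xi_1,\quad J\xi_3=\xi^*,\quad J\xi^*=-\xi_3,\quad JX^*=(\varphi X)^*\ \text{ for } X\perp\xi .$$ Assume that 1. $d\hat\eta_k(\xi_i,\xi^*)=0$ for $i,k=1,2,3$; 2. $d\hat\eta_i(X^*,\xi^*)=0$ for $i=1,2,3$ and every vector field $X\perp\xi$ on $B$; 3. $d\hat\eta_i((\varphi X)^*,(\varphi Y)^*)=d\hat\eta_i(X^*,Y^*)$ for $i=1,2,3$ and all vector fields $X,Y\perp\xi$ on $B$. Then $J$ is integrable: it is a smooth almost complex structure whose Nijenhuis tensor $[J,J](A_1,A_2)=[A_1,A_2]+J[JA_1,A_2]+J[A_1,JA_2]-[JA_1,JA_2]$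 vanishes identically. -/

import Mathlib

open scoped Quaternion Manifold ContDiff

noncomputable section

namespace HopfSasaki

/-! ### Quaternionic projective space as a smooth manifold -/

/-- The left quaternionic vector space `ℍ^(n+1)` with its Euclidean norm. -/
abbrev HV (n : ℕ) : Type := EuclideanSpace ℍ[ℝ] (Fin (n + 1))

/-- Quaternionic projective space: nonzero vectors of `ℍ^(n+1)` modulo left multiplication by
nonzero quaternions. -/
def HP (n : ℕ) : Type := Projectivization ℍ[ℝ] (HV n)

/-- The quotient topology. -/
instance (n : ℕ) : TopologicalSpace (HP n) :=
  TopologicalSpace.coinduced (Projectivization.mk' ℍ[ℝ] : {v : HV n // v ≠ 0} → HP n) inferInstance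

namespace HP

variable {n : ℕ}

/-- The class `[v]` of a nonzero vector. -/
def mk (v : HV n) (hv : v ≠ 0) : HP n := Projectivization.mk ℍ[ℝ] v hv

theorem mk_surj (x : HP n) : ∃ v : HV n, ∃ hv : v ≠ 0, mk v hv = x :=
  ⟨Projectivization.rep x, Projectivization.rep_nonzero x, Projectivization.mk_rep x⟩

theorem mk_eq_mk_iff {v w : HV n} (hv : v ≠ 0) (hw : w ≠ 0) :
    mk v hv = mk w hw ↔ ∃ q : ℍ[ℝ], q • w = v :=
  Projectivization.mk_eq_mk_iff' _ _ _ _ _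

theorem continuous_mk : Continuous (fun v : {v : HV n // v ≠ 0} => mk v.1 v.2) :=
  continuous_coinduced_rng

theorem isQuotientMap_mk : Topology.IsQuotientMap (fun v : {v : HV n // v ≠ 0} => mk v.1 v.2) :=
  ⟨⟨rfl⟩, fun x => by obtain ⟨v, hv, h⟩ := mk_surj x; exact ⟨⟨v, hv⟩, h⟩⟩

/-- The open set `{[v] : v a ≠ 0}`. -/
def dom (a : Fin (n + 1)) : Set (HP n) :=
  {x | Projectivization.lift (fun v : {v : HV n // v ≠ 0} => v.1 a ≠ 0) (by
    rintro ⟨v, hv⟩ ⟨w, hw⟩ t h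
    simp only at h
    have ht : t ≠ 0 := by rintro rfl; simp [h] at hv
    simp [h, ht]) x}

/-- The affine coordinates `[v] ↦ ((v a)⁻¹ * v b)`, `b ≠ a`. -/
def coord (a : Fin (n + 1)) (x : HP n) : Fin n → ℍ[ℝ] :=
  Projectivization.lift (fun v : {v : HV n // v ≠ 0} =>
    fun k : Fin n => (v.1 a)⁻¹ * v.1 (a.succAbove k)) (by
    rintro ⟨v, hv⟩ ⟨w, hw⟩ t h
    simp only at h
    have ht : t ≠ 0 := by rintro rfl; simp [h] at hv
    funext k
    simp [h, mul_assoc, ht]) x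

/-- The vector with entry `1` at `a` and the entries `z` elsewhere. -/
def affineVec (a : Fin (n + 1)) (z : Fin n → ℍ[ℝ]) : HV n :=
  WithLp.toLp 2 (a.insertNth (α := fun _ => ℍ[ℝ]) 1 z)

@[simp] theorem affineVec_same (a : Fin (n + 1)) (z : Fin n → ℍ[ℝ]) : affineVec a z a = 1 := by
  simp [affineVec]

@[simp] theorem affineVec_succAbove (a : Fin (n + 1)) (z : Fin n → ℍ[ℝ]) (k : Fin n) :
    affineVec a z (a.succAbove k) = z k := by
  simp [affineVec]

theorem affineVec_ne_zero (a : Fin (n + 1)) (z : Fin n → ℍ[ℝ]) : affineVec a z ≠ 0 := by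
  intro h
  have := affineVec_same a z
  rw [h] at this
  simp at this

theorem contDiff_affineVec (a : Fin (n + 1)) : ContDiff ℝ ∞ (affineVec (n := n) a) := by
  rw [contDiff_piLp]
  intro i
  refine Fin.succAboveCases a ?_ (fun k => ?_) i
  · simpa using contDiff_const
  · simpa using contDiff_apply ℝ ℍ[ℝ] k

@[simp] theorem mk_mem_dom {a : Fin (n + 1)} {v : HV n} {hv : v ≠ 0} :
    mk v hv ∈ dom a ↔ v a ≠ 0 := Iff.rfl

@[simp] theorem coord_mk (a : Fin (n + 1)) {v : HV n} {hv : v ≠ 0} :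
    coord a (mk v hv) = fun k => (v a)⁻¹ * v (a.succAbove k) := rfl

theorem smul_affineVec_coord {a : Fin (n + 1)} {v : HV n} {hv : v ≠ 0} (h : v a ≠ 0) :
    v a • affineVec a (coord a (mk v hv)) = v := by
  ext1 i
  refine Fin.succAboveCases a ?_ (fun k => ?_) i
  · simp
  · simp [h]

theorem mk_affineVec_coord {a : Fin (n + 1)} {x : HP n} (hx : x ∈ dom a) :
    mk (affineVec a (coord a x)) (affineVec_ne_zero _ _) = x := by
  obtain ⟨v, hv, rfl⟩ := mk_surj x
  rw [eq_comm, mk_eq_mk_iff]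
  exact ⟨v a, smul_affineVec_coord hx⟩

theorem isOpen_dom (a : Fin (n + 1)) : IsOpen (dom (n := n) a) := by
  rw [← isQuotientMap_mk.isOpen_preimage]
  have : Continuous fun v : {v : HV n // v ≠ 0} => v.1 a := by fun_prop
  exact isOpen_ne.preimage this

theorem continuousOn_coord (a : Fin (n + 1)) : ContinuousOn (coord (n := n) a) (dom a) := by
  have hq : Topology.IsQuotientMap
      ((dom (n := n) a).restrictPreimage (fun v : {v : HV n // v ≠ 0} => mk v.1 v.2)) :=
    isQuotientMap_mk.restrictPreimage_isOpen (isOpen_dom a)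
  rw [continuousOn_iff_continuous_domRestrict, hq.continuous_iff]
  refine continuous_pi fun k => ?_
  have h1 : Continuous fun v : ((fun v : {v : HV n // v ≠ 0} => mk v.1 v.2) ⁻¹' dom a) =>
      v.1.1 a := by fun_prop
  have h2 : Continuous fun v : ((fun v : {v : HV n // v ≠ 0} => mk v.1 v.2) ⁻¹' dom a) =>
      v.1.1 (a.succAbove k) := by fun_prop
  exact (h1.inv₀ fun v => v.2).mul h2

/-- The affine chart on `dom a`. -/
def chart (a : Fin (n + 1)) : OpenPartialHomeomorph (HP n) (Fin n → ℍ[ℝ]) where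
  toFun := coord a
  invFun z := mk (affineVec a z) (affineVec_ne_zero a z)
  source := dom a
  target := Set.univ
  map_source' _ _ := Set.mem_univ _
  map_target' z _ := by simp
  left_inv' x hx := mk_affineVec_coord hx
  right_inv' z _ := by funext k; simp
  open_source := isOpen_dom a
  open_target := isOpen_univ
  continuousOn_toFun := continuousOn_coord a
  continuousOn_invFun := by
    refine Continuous.continuousOn (continuous_mk.comp
      (g := fun v : {v : HV n // v ≠ 0} => mk v.1 v.2)
      (f := fun z => ⟨affineVec a z, affineVec_ne_zero a z⟩) ?_)
    exact (contDiff_affineVec a).continuous.subtype_mk _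

theorem exists_mem_dom (x : HP n) : ∃ a, x ∈ dom a := by
  obtain ⟨v, hv, rfl⟩ := mk_surj x
  by_contra! h
  apply hv
  ext1 a
  by_contra h'
  exact h a h'

/-- `HP n` is covered by the `n + 1` affine charts. -/
instance : ChartedSpace (Fin n → ℍ[ℝ]) (HP n) where
  atlas := Set.range chart
  chartAt x := chart (exists_mem_dom x).choose
  mem_chart_source _ := (exists_mem_dom _).choose_spec
  chart_mem_atlas _ := ⟨_, rfl⟩

theorem contDiffAt_quaternion_inv {q : ℍ[ℝ]} (hq : q ≠ 0) :
    ContDiffAt ℝ ∞ (fun q : ℍ[ℝ] => q⁻¹) q := by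
  have := contDiffAt_ringInverse ℝ (n := ∞) (Units.mk0 q hq)
  rwa [Ring.inverse_eq_inv'] at this

instance : IsManifold 𝓘(ℝ, Fin n → ℍ[ℝ]) ∞ (HP n) := by
  refine isManifold_of_contDiffOn _ _ _ ?_
  rintro _ _ ⟨a, rfl⟩ ⟨b, rfl⟩
  intro z hz
  have hz' : affineVec a z b ≠ 0 := by simpa [chart] using hz
  apply ContDiffAt.contDiffWithinAt
  have key : ContDiffAt ℝ ∞ (fun z => coord b (mk (affineVec a z) (affineVec_ne_zero a z))) z := by
    rw [contDiffAt_pi]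
    intro k
    simp only [coord_mk]
    have h := contDiff_piLp (p := 2) |>.1 (contDiff_affineVec (n := n) a)
    have h1 := ContDiffAt.comp z (contDiffAt_quaternion_inv hz') (h b).contDiffAt
    exact h1.mul (h (b.succAbove k)).contDiffAt
  exact key

end HP

/-! ### The Hopf bundle and the bundle induced by a map into `HP n` -/

instance : Fact (Module.finrank ℝ ℍ[ℝ] = 3 + 1) := ⟨Quaternion.finrank_eq_four⟩

/-- The group of unit quaternions. -/
abbrev S3 : Type := Metric.sphere (0 : ℍ[ℝ]) 1

/-- The unit sphere `S^(4n+3)` of `ℍ^(n+1)`. -/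
abbrev HSphere (n : ℕ) : Type := Metric.sphere (0 : HV n) 1

theorem HSphere.ne_zero {n : ℕ} (s : HSphere n) : s.1 ≠ 0 :=
  ne_zero_of_mem_unit_sphere s

/-- The Hopf map `S^(4n+3) → HP n`. -/
def hopf {n : ℕ} (s : HSphere n) : HP n := HP.mk s.1 s.ne_zero

/-- Left multiplication of unit quaternions on the sphere. -/
def rot {n : ℕ} (u : S3) (s : HSphere n) : HSphere n :=
  ⟨u.1 • s.1, by simp [norm_smul]⟩

@[simp] theorem hopf_rot {n : ℕ} (u : S3) (s : HSphere n) : hopf (rot u s) = hopf s :=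
  (HP.mk_eq_mk_iff _ _).2 ⟨u.1, rfl⟩

open Classical in
/-- Normalization of quaternions, with the value `1` at `0`. -/
def unitOf (q : ℍ[ℝ]) : S3 :=
  if h : q = 0 then ⟨1, by simp⟩ else ⟨‖q‖⁻¹ • q, by simp [norm_smul, h]⟩

theorem unitOf_coe {q : ℍ[ℝ]} (h : q ≠ 0) : (unitOf q).1 = ‖q‖⁻¹ • q := by
  simp [unitOf, h]

open Classical in
/-- On `dom a`, the unique representative whose entry at `a` is `1`; elsewhere any representative. -/
def repAt {n : ℕ} (a : Fin (n + 1)) (x : HP n) : HV n :=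
  if x ∈ HP.dom a then HP.affineVec a (HP.coord a x) else (HP.mk_surj x).choose

theorem exists_mk_repAt {n : ℕ} (a : Fin (n + 1)) (x : HP n) :
    ∃ h : repAt a x ≠ 0, HP.mk (repAt a x) h = x := by
  by_cases hx : x ∈ HP.dom a
  · simp only [repAt, hx, if_true]
    exact ⟨HP.affineVec_ne_zero _ _, HP.mk_affineVec_coord hx⟩
  · simp only [repAt, hx, if_false]
    exact (HP.mk_surj x).choose_spec

/-- The section of the Hopf map over `dom a` whose entry at `a` is a positive real number. -/
def unitSec {n : ℕ} (a : Fin (n + 1)) (x : HP n) : HSphere n :=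
  ⟨‖repAt a x‖⁻¹ • repAt a x, by simp [norm_smul, (exists_mk_repAt a x).1]⟩

@[simp] theorem hopf_unitSec {n : ℕ} (a : Fin (n + 1)) (x : HP n) : hopf (unitSec a x) = x := by
  obtain ⟨h, hx⟩ := exists_mk_repAt a x
  conv_rhs => rw [← hx]
  refine (HP.mk_eq_mk_iff _ _).2 ⟨((‖repAt a x‖⁻¹ : ℝ) : ℍ[ℝ]), ?_⟩
  ext1 i
  exact Quaternion.coe_mul_eq_smul _ _

theorem unitSec_apply_same {n : ℕ} {a : Fin (n + 1)} {x : HP n} (hx : x ∈ HP.dom a) :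
    (unitSec a x).1 a = ‖repAt a x‖⁻¹ • (1 : ℍ[ℝ]) := by
  simp only [unitSec, PiLp.smul_apply]
  rw [show repAt a x a = 1 by simp [repAt, hx]]

theorem rot_unitOf_unitSec {n : ℕ} {a : Fin (n + 1)} {s : HSphere n} (h : s.1 a ≠ 0) :
    rot (unitOf (s.1 a)) (unitSec a (hopf s)) = s := by
  have hd : hopf s ∈ HP.dom a := h
  have h1 : s.1 a • repAt a (hopf s) = s.1 := by
    simp only [repAt, hd, if_true]
    exact HP.smul_affineVec_coord h
  have h2 : ‖s.1 a‖ * ‖repAt a (hopf s)‖ = 1 := by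
    rw [← norm_smul, h1]; simp
  have h3 : ‖repAt a (hopf s)‖⁻¹ = ‖s.1 a‖ := (eq_inv_of_mul_eq_one_left h2).symm
  apply Subtype.ext
  change (unitOf (s.1 a)).1 • (‖repAt a (hopf s)‖⁻¹ • repAt a (hopf s)) = s.1
  rw [unitOf_coe h, h3]
  conv_rhs => rw [← h1]
  have : ‖s.1 a‖ ≠ 0 := by simpa using h
  rw [smul_assoc, smul_comm (s.1 a), smul_smul, inv_mul_cancel₀ this, one_smul]

theorem contMDiffOn_coord {n : ℕ} (a : Fin (n + 1)) :
    ContMDiffOn 𝓘(ℝ, Fin n → ℍ[ℝ]) 𝓘(ℝ, Fin n → ℍ[ℝ]) ∞ (HP.coord a) (HP.dom (n := n) a) :=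
  contMDiffOn_of_mem_maximalAtlas (e := HP.chart a)
    (IsManifold.subset_maximalAtlas ⟨a, rfl⟩)

theorem contMDiffOn_unitSec {n : ℕ} (a : Fin (n + 1)) :
    ContMDiffOn 𝓘(ℝ, Fin n → ℍ[ℝ]) 𝓘(ℝ, HV n) ∞ (fun x : HP n => (unitSec a x).1) (HP.dom a) := by
  have h1 : ContDiff ℝ ∞ fun z : Fin n → ℍ[ℝ] => ‖HP.affineVec a z‖⁻¹ • HP.affineVec a z := by
    have h := HP.contDiff_affineVec (n := n) a
    exact ((h.norm ℝ (HP.affineVec_ne_zero a)).inv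
      (fun z => norm_ne_zero_iff.2 (HP.affineVec_ne_zero a z))).smul h
  refine (h1.contMDiff.comp_contMDiffOn (contMDiffOn_coord a)).congr fun x hx => ?_
  simp [unitSec, repAt, hx]

/-- The model with corners of the total space `P`. -/
abbrev PModel (m : ℕ) := (𝓡 m).prod (𝓡 3)

variable {m n : ℕ} {B : Type*} [TopologicalSpace B] [ChartedSpace (EuclideanSpace ℝ (Fin m)) B]

/-- The total space of the `S^3`-bundle over `B` induced from the Hopf bundle by `f : B → HP n`,
i.e. the fibre product of `B` and `S^(4n+3)` over `HP n`. -/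
def InducedBundle (f : C^∞⟮𝓡 m, B; 𝓘(ℝ, Fin n → ℍ[ℝ]), HP n⟯) : Type _ :=
  {p : B × HSphere n // f p.1 = hopf p.2}

namespace InducedBundle

variable {f : C^∞⟮𝓡 m, B; 𝓘(ℝ, Fin n → ℍ[ℝ]), HP n⟯}

instance : TopologicalSpace (InducedBundle f) :=
  inferInstanceAs (TopologicalSpace {p : B × HSphere n // f p.1 = hopf p.2})

/-- The bundle projection `P → B`. -/
def proj (p : InducedBundle f) : B := p.1.1

/-- The canonical map `P → S^(4n+3)`. -/
def toSphere (p : InducedBundle f) : HSphere n := p.1.2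

/-- The canonical map `P → ℍ^(n+1)`. -/
def toHV (p : InducedBundle f) : HV n := p.toSphere.1

theorem map_proj (p : InducedBundle f) : f p.proj = hopf p.toSphere := p.2

theorem continuous_proj : Continuous (proj (f := f)) := continuous_fst.comp continuous_subtype_val

theorem continuous_toHV : Continuous (toHV (f := f)) :=
  continuous_subtype_val.comp (continuous_snd.comp continuous_subtype_val)

/-- The local trivialization of `P` over the preimage of `dom a`. -/
def triv (f : C^∞⟮𝓡 m, B; 𝓘(ℝ, Fin n → ℍ[ℝ]), HP n⟯) (a : Fin (n + 1)) :
    OpenPartialHomeomorph (InducedBundle f) (B × S3) where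
  toFun p := (p.proj, unitOf (p.toHV a))
  invFun y := ⟨(y.1, rot y.2 (unitSec a (f y.1))), by simp⟩
  source := {p | p.toHV a ≠ 0}
  target := {y | f y.1 ∈ HP.dom a}
  map_source' p hp := by
    change f p.proj ∈ HP.dom a
    rw [map_proj]; exact hp
  map_target' y hy := by
    change (rot y.2 (unitSec a (f y.1))).1 a ≠ 0
    have hu : y.2.1 ≠ 0 := ne_zero_of_mem_unit_sphere y.2
    simp only [rot, PiLp.smul_apply, unitSec_apply_same (show f y.1 ∈ HP.dom a from hy)]
    simp [hu, (exists_mk_repAt a (f y.1)).1]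
  left_inv' p hp := by
    refine Subtype.ext (Prod.ext rfl ?_)
    change rot (unitOf (p.toSphere.1 a)) (unitSec a (f p.proj)) = p.toSphere
    rw [map_proj]; exact rot_unitOf_unitSec hp
  right_inv' y hy := by
    refine Prod.ext rfl (Subtype.ext ?_)
    change (unitOf ((rot y.2 (unitSec a (f y.1))).1 a)).1 = y.2.1
    have hr := (exists_mk_repAt a (f y.1)).1
    have hr' : ‖repAt a (f y.1)‖ ≠ 0 := norm_ne_zero_iff.2 hr
    have hu : y.2.1 ≠ 0 := ne_zero_of_mem_unit_sphere y.2
    have h1 : (rot y.2 (unitSec a (f y.1))).1 a = ‖repAt a (f y.1)‖⁻¹ • y.2.1 := by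
      simp only [rot, PiLp.smul_apply, unitSec_apply_same (show f y.1 ∈ HP.dom a from hy)]
      simp
    rw [h1, unitOf_coe (by simp [hr, hu]), norm_smul, smul_smul]
    simp [hr']
  open_source := isOpen_ne.preimage (by
    have := continuous_toHV (f := f)
    fun_prop)
  open_target := (HP.isOpen_dom a).preimage (f.contMDiff.continuous.comp continuous_fst)
  continuousOn_toFun := by
    refine continuous_proj.continuousOn.prodMk ?_
    rw [Topology.IsInducing.subtypeVal.continuousOn_iff]
    have h0 : Continuous fun p : InducedBundle f => p.toHV a := by
      have := continuous_toHV (f := f)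
      fun_prop
    have h1 : ContinuousOn (fun p : InducedBundle f => ‖p.toHV a‖⁻¹ • p.toHV a)
        {p | p.toHV a ≠ 0} :=
      (h0.norm.continuousOn.inv₀ fun p hp => norm_ne_zero_iff.2 hp).smul h0.continuousOn
    exact h1.congr fun p hp => unitOf_coe hp
  continuousOn_invFun := by
    refine (Topology.IsInducing.subtypeVal (t := {p : B × HSphere n |
      f p.1 = hopf p.2})).continuousOn_iff.2 ?_
    refine continuous_fst.continuousOn.prodMk ?_
    rw [Topology.IsInducing.subtypeVal.continuousOn_iff]
    have h1 : ContinuousOn (fun y : B × S3 => (unitSec a (f y.1)).1) {y | f y.1 ∈ HP.dom a} :=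
      (contMDiffOn_unitSec a).continuousOn.comp
        (f.contMDiff.continuous.comp continuous_fst).continuousOn fun y hy => hy
    exact (continuous_subtype_val.comp continuous_snd).continuousOn.smul h1

theorem exists_mem_source (p : InducedBundle f) : ∃ a, p ∈ (triv f a).source := by
  by_contra! h
  apply p.toSphere.ne_zero
  ext1 a
  by_contra h'
  exact h a h'

/-- `P` is covered by the `n + 1` local trivializations. -/
@[reducible] def chartedSpaceProd (f : C^∞⟮𝓡 m, B; 𝓘(ℝ, Fin n → ℍ[ℝ]), HP n⟯) :
    ChartedSpace (B × S3) (InducedBundle f) where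
  atlas := Set.range (triv f)
  chartAt p := triv f (exists_mem_source p).choose
  mem_chart_source p := (exists_mem_source p).choose_spec
  chart_mem_atlas _ := ⟨_, rfl⟩

/-- The smooth structure of `P`: its charts are those of `B × S^3` composed with the local
trivializations. -/
instance : ChartedSpace (ModelProd (EuclideanSpace ℝ (Fin m)) (EuclideanSpace ℝ (Fin 3)))
    (InducedBundle f) :=
  letI := chartedSpaceProd f
  ChartedSpace.comp _ (B × S3) _

theorem contMDiffOn_unitOf : ContMDiffOn 𝓘(ℝ, ℍ[ℝ]) (𝓡 3) ∞ unitOf {0}ᶜ := by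
  let U : TopologicalSpace.Opens ℍ[ℝ] := ⟨{0}ᶜ, isOpen_compl_singleton⟩
  have h1 : ContMDiffOn 𝓘(ℝ, ℍ[ℝ]) 𝓘(ℝ, ℍ[ℝ]) ∞ (fun q : ℍ[ℝ] => ‖q‖⁻¹ • q) {0}ᶜ := by
    rw [contMDiffOn_iff_contDiffOn]
    intro q hq
    have hq : q ≠ 0 := hq
    exact (((contDiffAt_norm ℝ hq).inv (norm_ne_zero_iff.2 hq)).smul
      contDiffAt_id).contDiffWithinAt
  have h2 : ContMDiff 𝓘(ℝ, ℍ[ℝ]) 𝓘(ℝ, ℍ[ℝ]) ∞ (fun q : U => (unitOf q.1).1) := by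
    intro q
    have h := (h1 q.1 q.2).contMDiffAt (U.isOpen.mem_nhds q.2)
    refine (h.comp q (contMDiff_subtype_val q)).congr_of_eventuallyEq ?_
    exact Filter.Eventually.of_forall fun r => unitOf_coe r.2
  intro q hq
  refine ContMDiffAt.contMDiffWithinAt ?_
  have h3 := (h2.codRestrict_sphere (n := 3) fun q => (unitOf q.1).2) ⟨q, hq⟩
  exact (contMDiffAt_subtype_iff (U := U) (f := unitOf) (x := ⟨q, hq⟩)).1 h3

/-- The local trivializations are related by smooth maps. -/
theorem contMDiffOn_triv_symm_triv (f : C^∞⟮𝓡 m, B; 𝓘(ℝ, Fin n → ℍ[ℝ]), HP n⟯)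
    (a b : Fin (n + 1)) :
    ContMDiffOn ((𝓡 m).prod (𝓡 3)) ((𝓡 m).prod (𝓡 3)) ∞ ((triv f a).symm.trans (triv f b))
      ((triv f a).symm.trans (triv f b)).source := by
  have h1 : ContMDiffOn ((𝓡 m).prod (𝓡 3)) 𝓘(ℝ, HV n) ∞
      (fun y : B × S3 => (unitSec a (f y.1)).1) {y | f y.1 ∈ HP.dom a} :=
    (contMDiffOn_unitSec a).comp (f.contMDiff.comp contMDiff_fst).contMDiffOn fun y hy => hy
  have h2 : ContMDiffOn ((𝓡 m).prod (𝓡 3)) 𝓘(ℝ, ℍ[ℝ]) ∞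
      (fun y : B × S3 => (unitSec a (f y.1)).1 b) {y | f y.1 ∈ HP.dom a} := by
    have : ContDiff ℝ ∞ fun v : HV n => v b := contDiff_piLp_apply 2
    exact this.contMDiff.comp_contMDiffOn h1
  have h3 : ContMDiffOn ((𝓡 m).prod (𝓡 3)) 𝓘(ℝ, ℍ[ℝ]) ∞
      (fun y : B × S3 => y.2.1 * (unitSec a (f y.1)).1 b) {y | f y.1 ∈ HP.dom a} := by
    have h4 : ContMDiffOn ((𝓡 m).prod (𝓡 3)) 𝓘(ℝ, ℍ[ℝ]) ∞
        (fun y : B × S3 => y.2.1) {y | f y.1 ∈ HP.dom a} :=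
      (contMDiff_coe_sphere.comp contMDiff_snd).contMDiffOn
    have h5 : ContDiff ℝ ∞ fun q : ℍ[ℝ] × ℍ[ℝ] => q.1 * q.2 := contDiff_fst.mul contDiff_snd
    exact h5.contMDiff.comp_contMDiffOn (h4.prodMk_space h2)
  refine contMDiffOn_fst.prodMk ?_
  refine contMDiffOn_unitOf.comp (h3.mono fun y hy => ?_) fun y hy => ?_
  · exact hy.1
  · exact hy.2

instance [IsManifold (𝓡 m) ∞ B] : IsManifold ((𝓡 m).prod (𝓡 3)) ∞ (InducedBundle f) := by
  refine isManifold_of_contDiffOn _ _ _ ?_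
  rintro _ _ ⟨_, ⟨a, rfl⟩, c, hc, rfl⟩ ⟨_, ⟨b, rfl⟩, c', hc', rfl⟩
  have h1 : ContMDiffOn ((𝓡 m).prod (𝓡 3)) ((𝓡 m).prod (𝓡 3)) ∞
      (((triv f a).trans c).symm.trans ((triv f b).trans c'))
      (((triv f a).trans c).symm.trans ((triv f b).trans c')).source := by
    have hc1 := contMDiffOn_symm_of_mem_maximalAtlas (I := (𝓡 m).prod (𝓡 3)) (n := ∞)
      (IsManifold.subset_maximalAtlas hc)
    have hc2 := contMDiffOn_of_mem_maximalAtlas (I := (𝓡 m).prod (𝓡 3)) (n := ∞)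
      (IsManifold.subset_maximalAtlas hc')
    refine (hc2.comp ((contMDiffOn_triv_symm_triv f a b).comp (hc1.mono ?_) ?_) ?_).congr ?_
    · intro y hy
      simp only [mfld_simps] at hy ⊢
      exact hy.1.1
    · intro y hy
      simp only [mfld_simps] at hy ⊢
      exact ⟨hy.1.2, hy.2.1⟩
    · intro y hy
      simp only [mfld_simps] at hy ⊢
      exact hy.2.2
    · intro y hy
      simp only [mfld_simps]
  have h2 := (contMDiffOn_iff.1 h1).2
  rcases Set.eq_empty_or_nonempty
    (((triv f a).trans c).symm.trans ((triv f b).trans c')).source with h0 | ⟨y, _⟩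
  · rw [h0]
    simp [contDiffOn_empty]
  · have h3 := h2 y y
    simp only [mfld_simps] at h3 ⊢
    refine h3.mono ?_
    intro z hz
    simp only [mfld_simps] at hz ⊢
    tauto

section Smoothness

variable [IsManifold (𝓡 m) ∞ B]

theorem contMDiffOn_triv (a : Fin (n + 1)) :
    ContMDiffOn (PModel m) (PModel m) ∞ (triv f a) (triv f a).source := by
  intro p hp
  let b := (exists_mem_source p).choose
  have hb : p ∈ (triv f b).source := (exists_mem_source p).choose_spec
  let c := chartAt (ModelProd (EuclideanSpace ℝ (Fin m)) (EuclideanSpace ℝ (Fin 3))) (triv f b p)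
  have h1 : ContMDiffAt (PModel m) (PModel m) ∞ ((triv f b).trans c) p :=
    contMDiffAt_of_mem_maximalAtlas (IsManifold.chart_mem_maximalAtlas p)
      (mem_chart_source (ModelProd (EuclideanSpace ℝ (Fin m)) (EuclideanSpace ℝ (Fin 3))) p)
  have h2 : ContMDiffAt (PModel m) (PModel m) ∞ c.symm (c (triv f b p)) :=
    contMDiffAt_symm_of_mem_maximalAtlas (IsManifold.chart_mem_maximalAtlas _)
      (c.map_source (mem_chart_source _ _))
  have hs : triv f b p ∈ ((triv f b).symm.trans (triv f a)).source := by
    simp only [mfld_simps, hb]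
    exact hp
  have h3 := (contMDiffOn_triv_symm_triv f b a).contMDiffAt
    (((triv f b).symm.trans (triv f a)).open_source.mem_nhds hs)
  have h4 : c.symm (c (triv f b p)) = triv f b p := c.left_inv (mem_chart_source _ _)
  refine ContMDiffAt.contMDiffWithinAt ?_
  refine ((ContMDiffAt.comp_of_eq h3 h2 h4).comp p h1).congr_of_eventuallyEq ?_
  have hU := ((triv f b).trans c).open_source.mem_nhds (x := p) (by
    simp only [mfld_simps, hb]; exact mem_chart_source _ _)
  filter_upwards [hU] with x hx
  simp only [mfld_simps] at hx
  simp [hx.1, hx.2]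

theorem contMDiffOn_triv_symm (a : Fin (n + 1)) :
    ContMDiffOn (PModel m) (PModel m) ∞ (triv f a).symm (triv f a).target := by
  intro y hy
  set p := (triv f a).symm y with hpdef
  have hpa : p ∈ (triv f a).source := (triv f a).map_target hy
  let b := (exists_mem_source p).choose
  have hb : p ∈ (triv f b).source := (exists_mem_source p).choose_spec
  let c := chartAt (ModelProd (EuclideanSpace ℝ (Fin m)) (EuclideanSpace ℝ (Fin 3))) (triv f b p)
  have hpE : p ∈ ((triv f b).trans c).source :=
    mem_chart_source (ModelProd (EuclideanSpace ℝ (Fin m)) (EuclideanSpace ℝ (Fin 3))) p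
  have h1 : ContMDiffAt (PModel m) (PModel m) ∞ ((triv f b).trans c).symm
      ((triv f b).trans c p) :=
    contMDiffAt_symm_of_mem_maximalAtlas (IsManifold.chart_mem_maximalAtlas p)
      (((triv f b).trans c).map_source hpE)
  have h2 : ContMDiffAt (PModel m) (PModel m) ∞ c (triv f b p) :=
    contMDiffAt_of_mem_maximalAtlas (IsManifold.chart_mem_maximalAtlas _)
      (mem_chart_source _ _)
  have hs : y ∈ ((triv f a).symm.trans (triv f b)).source := by
    simp only [mfld_simps]
    exact ⟨hy, hb⟩
  have h3 := (contMDiffOn_triv_symm_triv f a b).contMDiffAt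
    (((triv f a).symm.trans (triv f b)).open_source.mem_nhds hs)
  refine ContMDiffAt.contMDiffWithinAt ?_
  refine (ContMDiffAt.comp_of_eq h1 (ContMDiffAt.comp_of_eq h2 h3 rfl) rfl).congr_of_eventuallyEq ?_
  have hU := ((triv f a).symm.trans ((triv f b).trans c)).open_source.mem_nhds (x := y) (by
    rw [OpenPartialHomeomorph.trans_source]
    exact ⟨hy, hpE⟩)
  filter_upwards [hU] with x hx
  simp only [mfld_simps] at hx
  simp [hx.2.1, hx.2.2]

theorem contMDiff_proj : ContMDiff (PModel m) (𝓡 m) ∞ (proj (f := f)) := by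
  intro p
  obtain ⟨a, ha⟩ := exists_mem_source p
  have h := (contMDiffOn_triv (f := f) a).contMDiffAt ((triv f a).open_source.mem_nhds ha)
  have h2 : ContMDiffAt (PModel m) (𝓡 m) ∞ (Prod.fst : B × S3 → B) (triv f a p) :=
    contMDiffAt_fst
  exact h2.comp p h

theorem contMDiff_toHV : ContMDiff (PModel m) 𝓘(ℝ, HV n) ∞ (toHV (f := f)) := by
  intro p
  obtain ⟨a, ha⟩ := exists_mem_source p
  have h := (contMDiffOn_triv (f := f) a).contMDiffAt ((triv f a).open_source.mem_nhds ha)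
  have ht : triv f a p ∈ (triv f a).target := (triv f a).map_source ha
  have h1 : ContMDiffOn (PModel m) 𝓘(ℝ, HV n) ∞
      (fun y : B × S3 => (unitSec a (f y.1)).1) (triv f a).target :=
    (contMDiffOn_unitSec a).comp (f.contMDiff.comp contMDiff_fst).contMDiffOn fun y hy => hy
  have h4 : ContMDiffOn (PModel m) 𝓘(ℝ, ℍ[ℝ]) ∞ (fun y : B × S3 => y.2.1) (triv f a).target :=
    (contMDiff_coe_sphere.comp contMDiff_snd).contMDiffOn
  have h5 : ContDiff ℝ ∞ fun q : ℍ[ℝ] × HV n => q.1 • q.2 := contDiff_fst.smul contDiff_snd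
  have h6 := h5.contMDiff.comp_contMDiffOn (h4.prodMk_space h1)
  have h7 := h6.contMDiffAt ((triv f a).open_target.mem_nhds ht)
  refine (h7.comp p h).congr_of_eventuallyEq ?_
  filter_upwards [(triv f a).open_source.mem_nhds ha] with q hq
  have := congrArg (fun q : InducedBundle f => q.toHV) ((triv f a).left_inv hq)
  exact this.symm

end Smoothness

/-- The differential of the bundle projection `P → B`. -/
def dproj (p : InducedBundle f) : TangentSpace (PModel m) p →L[ℝ] TangentSpace (𝓡 m) p.proj :=
  mfderiv (PModel m) (𝓡 m) proj p

/-- The differential of the canonical map `P → ℍ^(n+1)`. -/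
def dtoHV (p : InducedBundle f) : TangentSpace (PModel m) p →L[ℝ] HV n :=
  mvfderiv (PModel m) toHV p

end InducedBundle

/-- The imaginary unit quaternions `i, j, k`. -/
def imUnit : Fin 3 → ℍ[ℝ] := ![⟨0, 1, 0, 0⟩, ⟨0, 0, 1, 0⟩, ⟨0, 0, 0, 1⟩]

namespace InducedBundle

variable {f : C^∞⟮𝓡 m, B; 𝓘(ℝ, Fin n → ℍ[ℝ]), HP n⟯}

/-- The connection form of the connection on `P` induced from the Hopf bundle, whose horizontal
spaces are the orthogonal complements of the orbits in the Euclidean metric of `ℍ^(n+1)`: its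
`i`-th component is the Euclidean inner product with the vector `-e_i x`, `e_i ∈ {i, j, k}`. -/
def connForm (i : Fin 3) (p : InducedBundle f) : TangentSpace (PModel m) p →L[ℝ] ℝ :=
  (innerSL ℝ (-(imUnit i • p.toHV))).comp (dtoHV p)

theorem inner_quaternion (q r : ℍ[ℝ]) :
    (inner ℝ q r : ℝ) = q.re * r.re + q.imI * r.imI + q.imJ * r.imJ + q.imK * r.imK := by
  rw [Quaternion.inner_def, Quaternion.re_mul]
  simp

theorem norm_toHV (p : InducedBundle f) : ‖p.toHV‖ = 1 := by
  simp [toHV]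

theorem inner_smul_toHV (p : InducedBundle f) (q r : ℍ[ℝ]) :
    inner ℝ (q • p.toHV) (r • p.toHV) = (inner ℝ q r : ℝ) := by
  have h := norm_toHV p
  have h1 : ∀ x : ℍ[ℝ], inner ℝ (q * x) (r * x) = ‖x‖ ^ 2 * (inner ℝ q r : ℝ) := by
    intro x
    have h2 : ‖x‖ ^ 2 = inner ℝ x x := (real_inner_self_eq_norm_sq x).symm
    rw [h2]
    simp only [inner_quaternion, Quaternion.re_mul, Quaternion.imI_mul, Quaternion.imJ_mul,
      Quaternion.imK_mul]
    ring
  rw [PiLp.inner_apply]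
  simp only [PiLp.smul_apply, smul_eq_mul, h1]
  rw [← Finset.sum_mul, ← PiLp.norm_sq_eq_of_L2, h]
  simp

theorem connForm_vertical (i j : Fin 3) (p : InducedBundle f) (w : TangentSpace (PModel m) p)
    (hw : dtoHV p w = -(imUnit i • p.toHV)) : connForm j p w = if i = j then 1 else 0 := by
  have : connForm j p w = inner ℝ (-(imUnit j • p.toHV)) (dtoHV p w) := rfl
  rw [this, hw, inner_neg_neg, inner_smul_toHV, inner_quaternion]
  fin_cases i <;> fin_cases j <;> simp [imUnit]

section Existence

variable [IsManifold (𝓡 m) ∞ B]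

theorem mdifferentiableAt_triv {a : Fin (n + 1)} {p : InducedBundle f}
    (ha : p ∈ (triv f a).source) : MDifferentiableAt (PModel m) (PModel m) (triv f a) p :=
  ((contMDiffOn_triv (f := f) a).contMDiffAt
    ((triv f a).open_source.mem_nhds ha)).mdifferentiableAt (by simp)

theorem mdifferentiableAt_triv_symm {a : Fin (n + 1)} {y : B × S3}
    (hy : y ∈ (triv f a).target) : MDifferentiableAt (PModel m) (PModel m) (triv f a).symm y :=
  ((contMDiffOn_triv_symm (f := f) a).contMDiffAt
    ((triv f a).open_target.mem_nhds hy)).mdifferentiableAt (by simp)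

theorem mdifferentiable_proj (p : InducedBundle f) :
    MDifferentiableAt (PModel m) (𝓡 m) proj p :=
  contMDiff_proj.contMDiffAt.mdifferentiableAt (by simp)

theorem mdifferentiable_toHV (p : InducedBundle f) :
    MDifferentiableAt (PModel m) 𝓘(ℝ, HV n) toHV p :=
  contMDiff_toHV.contMDiffAt.mdifferentiableAt (by simp)

theorem eq_zero_of_dproj_dtoHV (p : InducedBundle f) (w : TangentSpace (PModel m) p)
    (h1 : dproj p w = 0) (h2 : dtoHV p w = 0) : w = 0 := by
  obtain ⟨a, ha⟩ := exists_mem_source p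
  have hsnd : MDifferentiableAt (PModel m) (𝓡 3) (fun q : InducedBundle f => unitOf (q.toHV a)) p :=
    mdifferentiableAt_snd.comp p (mdifferentiableAt_triv ha)
  have hL : ContDiff ℝ ∞ fun v : HV n => v a := contDiff_piLp_apply 2
  have hu : MDifferentiableAt 𝓘(ℝ, HV n) (𝓡 3) (fun v : HV n => unitOf (v a)) p.toHV := by
    have h3 := (contMDiffOn_unitOf.contMDiffAt (isOpen_compl_singleton.mem_nhds (x := p.toHV a) ha))
    exact (h3.comp p.toHV hL.contMDiff.contMDiffAt).mdifferentiableAt (by simp)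
  have hd2 : mfderiv (PModel m) (𝓡 3) (fun q : InducedBundle f => unitOf (q.toHV a)) p w = 0 := by
    have h4 := mfderiv_comp_apply p hu (mdifferentiable_toHV p) w
    have h5 : mfderiv (PModel m) 𝓘(ℝ, HV n) toHV p w = 0 := h2
    rw [h5, map_zero] at h4
    exact h4
  have hd : mfderiv (PModel m) (PModel m) (triv f a) p w = 0 := by
    have h6 : mfderiv (PModel m) (PModel m) (triv f a) p = _ :=
      (mdifferentiable_proj p).mfderiv_prod hsnd
    rw [h6]
    exact Prod.ext h1 hd2
  have hs := mdifferentiableAt_triv_symm ((triv f a).map_source ha)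
  have h7 := mfderiv_comp_apply p hs (mdifferentiableAt_triv ha) w
  rw [hd, map_zero] at h7
  have h8 : (triv f a).symm ∘ (triv f a) =ᶠ[nhds p] id := by
    filter_upwards [(triv f a).open_source.mem_nhds ha] with q hq
    exact (triv f a).left_inv hq
  rw [h8.mfderiv_eq, mfderiv_id] at h7
  exact h7

theorem dtoHV_of_dproj_eq_zero (p : InducedBundle f) (w : TangentSpace (PModel m) p)
    (h1 : dproj p w = 0) : ∃ q : ℍ[ℝ], dtoHV p w = q • p.toHV := by
  obtain ⟨a, ha⟩ := exists_mem_source p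
  have hsnd : MDifferentiableAt (PModel m) 𝓘(ℝ, ℍ[ℝ])
      (fun q : InducedBundle f => (unitOf (q.toHV a)).1) p :=
    ((contMDiff_coe_sphere (n := 3) (m := ∞) _).mdifferentiableAt (by simp)).comp p
      (mdifferentiableAt_snd.comp p (mdifferentiableAt_triv ha))
  have hfp : f p.proj ∈ HP.dom a := (triv f a).map_source ha
  let G : B × ℍ[ℝ] → HV n := fun y => y.2 • (unitSec a (f y.1)).1
  let k : InducedBundle f → B × ℍ[ℝ] := fun q => (q.proj, (unitOf (q.toHV a)).1)
  have hG : MDifferentiableAt ((𝓡 m).prod 𝓘(ℝ, ℍ[ℝ])) 𝓘(ℝ, HV n) G (k p) := by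
    have hσ : ContMDiffAt ((𝓡 m).prod 𝓘(ℝ, ℍ[ℝ])) 𝓘(ℝ, HV n) ∞
        (fun y : B × ℍ[ℝ] => (unitSec a (f y.1)).1) (k p) :=
      ContMDiffAt.comp (g := fun x : HP n => (unitSec a x).1) (k p)
        ((contMDiffOn_unitSec a).contMDiffAt ((HP.isOpen_dom a).mem_nhds hfp))
        ((f.contMDiff.comp (contMDiff_fst (M := B) (N := ℍ[ℝ]) (I := 𝓡 m)
          (J := 𝓘(ℝ, ℍ[ℝ])))).contMDiffAt)
    have h5 : ContDiff ℝ ∞ fun q : ℍ[ℝ] × HV n => q.1 • q.2 := contDiff_fst.smul contDiff_snd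
    exact (h5.contMDiff.contMDiffAt.comp (k p)
      (contMDiffAt_snd.prodMk_space hσ)).mdifferentiableAt (by simp)
  have hk : MDifferentiableAt (PModel m) ((𝓡 m).prod 𝓘(ℝ, ℍ[ℝ])) k p :=
    (mdifferentiable_proj p).prodMk hsnd
  have heq : toHV =ᶠ[nhds p] G ∘ k := by
    filter_upwards [(triv f a).open_source.mem_nhds ha] with q hq
    exact (congrArg (fun q : InducedBundle f => q.toHV) ((triv f a).left_inv hq)).symm
  have hkw : mfderiv (PModel m) ((𝓡 m).prod 𝓘(ℝ, ℍ[ℝ])) k p w =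
      ((0 : EuclideanSpace ℝ (Fin m)),
        (mfderiv (PModel m) 𝓘(ℝ, ℍ[ℝ]) (fun q : InducedBundle f => (unitOf (q.toHV a)).1) p w
          : ℍ[ℝ])) := by
    have h6 : mfderiv (PModel m) ((𝓡 m).prod 𝓘(ℝ, ℍ[ℝ])) k p = _ :=
      (mdifferentiable_proj p).mfderiv_prod hsnd
    rw [h6]
    exact Prod.ext h1 rfl
  set r : ℍ[ℝ] :=
    mfderiv (PModel m) 𝓘(ℝ, ℍ[ℝ]) (fun q : InducedBundle f => (unitOf (q.toHV a)).1) p w with hr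
  have h9 : dtoHV p w = r • (unitSec a (f p.proj)).1 := by
    have h7 : mfderiv (PModel m) 𝓘(ℝ, HV n) toHV p w =
        mfderiv ((𝓡 m).prod 𝓘(ℝ, ℍ[ℝ])) 𝓘(ℝ, HV n) G (k p)
          (mfderiv (PModel m) ((𝓡 m).prod 𝓘(ℝ, ℍ[ℝ])) k p w) := by
      rw [heq.mfderiv_eq]
      exact mfderiv_comp_apply p hG hk w
    have h7' := h7.trans ((congrArg _ hkw).trans (mfderiv_prod_eq_add_apply hG))
    let L : ℍ[ℝ] →L[ℝ] HV n :=
      (LinearMap.toContinuousLinearMap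
        { toFun := fun z => z • (unitSec a (f p.proj)).1
          map_add' := fun x y => add_smul _ _ _
          map_smul' := fun c x => by simp [smul_assoc] })
    have h8 : mfderiv 𝓘(ℝ, ℍ[ℝ]) 𝓘(ℝ, HV n) (fun z : ℍ[ℝ] => G ((k p).1, z)) (k p).2 = L := by
      rw [mfderiv_eq_fderiv]
      exact L.fderiv
    rw [h8] at h7'
    refine h7'.trans ?_
    exact (congrArg (fun y : HV n => y + L r) (map_zero (mfderiv (𝓡 m) 𝓘(ℝ, HV n)
      (fun z : B => G (z, (k p).2)) (k p).1))).trans (zero_add (L r))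
  have h10 : p.toHV = (unitOf (p.toHV a)).1 • (unitSec a (f p.proj)).1 :=
    (congrArg (fun q : InducedBundle f => q.toHV) ((triv f a).left_inv ha)).symm
  have hne : (unitOf (p.toHV a)).1 ≠ 0 := ne_zero_of_mem_unit_sphere _
  refine ⟨r * (unitOf (p.toHV a)).1⁻¹, ?_⟩
  have h11 : (r * (unitOf (p.toHV a)).1⁻¹) • p.toHV =
      (r * (unitOf (p.toHV a)).1⁻¹) • ((unitOf (p.toHV a)).1 • (unitSec a (f p.proj)).1) :=
    congrArg _ h10
  rw [h9, h11, smul_smul, mul_assoc, inv_mul_cancel₀ hne, mul_one]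

theorem inner_dtoHV_toHV (p : InducedBundle f) (w : TangentSpace (PModel m) p) :
    inner ℝ (dtoHV p w) p.toHV = 0 := by
  let N : HV n → ℝ := fun v => ‖v‖ ^ 2
  have hN : HasFDerivAt N (2 • innerSL ℝ p.toHV) p.toHV :=
    (hasStrictFDerivAt_norm_sq p.toHV).hasFDerivAt
  have h1 := hN.hasMFDerivAt.comp p (mdifferentiable_toHV p).hasMFDerivAt
  have h2 : N ∘ toHV = fun _ : InducedBundle f => (1 : ℝ) := by
    funext q; simp [N, norm_toHV]
  rw [h2] at h1
  have h3 := congrArg (fun L => L w) (hasMFDerivAt_unique h1 (hasMFDerivAt_const (1 : ℝ) p))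
  have h4 : (2 • innerSL ℝ p.toHV) (dtoHV p w) = (0 : ℝ) := h3
  rw [real_inner_comm]
  simpa using h4

theorem existsUnique_vertical (i : Fin 3) (p : InducedBundle f) :
    ∃! w : TangentSpace (PModel m) p, dproj p w = 0 ∧ dtoHV p w = -(imUnit i • p.toHV) := by
  obtain ⟨a, ha⟩ := exists_mem_source p
  have hfp : f p.proj ∈ HP.dom a := (triv f a).map_source ha
  have himn : ∀ t : ℝ, ‖((Real.cos t : ℝ) : ℍ[ℝ]) - Real.sin t • imUnit i‖ = 1 := by
    intro t
    have h : ‖((Real.cos t : ℝ) : ℍ[ℝ]) - Real.sin t • imUnit i‖ ^ 2 = 1 := by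
      have h1 := Real.cos_sq_add_sin_sq t
      rw [← real_inner_self_eq_norm_sq, inner_quaternion]
      simp only [Quaternion.re_sub, Quaternion.imI_sub, Quaternion.imJ_sub, Quaternion.imK_sub,
        Quaternion.re_smul, Quaternion.imI_smul, Quaternion.imJ_smul, Quaternion.imK_smul,
        Quaternion.re_coe, Quaternion.imI_coe, Quaternion.imJ_coe, Quaternion.imK_coe]
      fin_cases i <;> simp [imUnit] <;> linarith
    exact (pow_eq_one_iff_of_nonneg (norm_nonneg _) two_ne_zero).1 h
  let u : S3 := unitOf (p.toHV a)
  let c : ℝ → ℍ[ℝ] := fun t => (((Real.cos t : ℝ) : ℍ[ℝ]) - Real.sin t • imUnit i) * u.1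
  have hc0 : c 0 = u.1 := by simp [c]
  have hcS : ∀ t, c t ∈ Metric.sphere (0 : ℍ[ℝ]) 1 := by
    intro t; simp [c, himn]
  have hcd : ContDiff ℝ ∞ c := by
    have h1 : ContDiff ℝ ∞ fun t : ℝ => ((Real.cos t : ℝ) : ℍ[ℝ]) := by
      have : (fun t : ℝ => ((Real.cos t : ℝ) : ℍ[ℝ])) = fun t => Real.cos t • (1 : ℍ[ℝ]) := by
        funext t; rw [← Quaternion.coe_mul_eq_smul, mul_one]
      rw [this]
      exact Real.contDiff_cos.smul contDiff_const
    exact (h1.sub (Real.contDiff_sin.smul contDiff_const)).mul contDiff_const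
  let γ : ℝ → InducedBundle f := fun t => (triv f a).symm (p.proj, Set.codRestrict c _ hcS t)
  have hγ0 : γ 0 = p := by
    have h : Set.codRestrict c _ hcS 0 = u := Subtype.ext hc0
    change (triv f a).symm (p.proj, Set.codRestrict c _ hcS 0) = p
    rw [h]
    exact (triv f a).left_inv ha
  have hγ : MDifferentiableAt 𝓘(ℝ, ℝ) (PModel m) γ 0 := by
    have h1 : ContMDiff 𝓘(ℝ, ℝ) (𝓡 3) ∞ (Set.codRestrict c _ hcS) :=
      hcd.contMDiff.codRestrict_sphere hcS
    have h2 : MDifferentiableAt (PModel m) (PModel m) (triv f a).symm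
        (p.proj, Set.codRestrict c _ hcS 0) := mdifferentiableAt_triv_symm hfp
    exact h2.comp (0 : ℝ)
      ((contMDiff_const.prodMk h1).contMDiffAt.mdifferentiableAt (by simp))
  have hproj : proj ∘ γ = fun _ => p.proj := rfl
  have htoHV : toHV ∘ γ = fun t => (((Real.cos t : ℝ) : ℍ[ℝ]) - Real.sin t • imUnit i) •
      p.toHV := by
    funext t
    have h10 : p.toHV = u.1 • (unitSec a (f p.proj)).1 :=
      (congrArg (fun q : InducedBundle f => q.toHV) ((triv f a).left_inv ha)).symm
    rw [h10, smul_smul]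
    rfl
  let w : TangentSpace (PModel m) p := mfderiv 𝓘(ℝ, ℝ) (PModel m) γ 0 (1 : ℝ)
  have hw1 : dproj p w = 0 := by
    have h := mfderiv_comp_apply_of_eq (0 : ℝ) (mdifferentiable_proj p) hγ hγ0 (1 : ℝ)
    rw [hproj, mfderiv_const] at h
    exact h.symm
  have hw2 : dtoHV p w = -(imUnit i • p.toHV) := by
    have h := mfderiv_comp_apply_of_eq (0 : ℝ) (mdifferentiable_toHV p) hγ hγ0 (1 : ℝ)
    have hd : HasDerivAt (fun t : ℝ => (((Real.cos t : ℝ) : ℍ[ℝ]) - Real.sin t • imUnit i) •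
        p.toHV) (-(imUnit i • p.toHV)) 0 := by
      have e : (fun t : ℝ => (((Real.cos t : ℝ) : ℍ[ℝ]) - Real.sin t • imUnit i) • p.toHV) =
          fun t => Real.cos t • p.toHV - Real.sin t • (imUnit i • p.toHV) := by
        funext t
        rw [sub_smul, smul_assoc]
        congr 1
        ext1 k
        exact Quaternion.coe_mul_eq_smul _ _
      rw [e]
      have h1 := ((Real.hasDerivAt_cos 0).smul_const p.toHV).sub
        ((Real.hasDerivAt_sin 0).smul_const (imUnit i • p.toHV))
      exact h1.congr_deriv (by simp)
    rw [htoHV, mfderiv_eq_fderiv] at h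
    have h' := hd.hasFDerivAt.fderiv
    rw [h'] at h
    refine Eq.trans (Eq.symm h) ?_
    exact one_smul ℝ (-(imUnit i • p.toHV))
  refine ⟨w, ⟨hw1, hw2⟩, fun w' hw' => ?_⟩
  have h := eq_zero_of_dproj_dtoHV p (w' - w) (by rw [map_sub, hw'.1, hw1, sub_zero])
    (by rw [map_sub, hw'.2, hw2, sub_self])
  exact sub_eq_zero.1 h

theorem existsUnique_horizontalLift (p : InducedBundle f) (v : TangentSpace (𝓡 m) p.proj) :
    ∃! w : TangentSpace (PModel m) p, dproj p w = v ∧ ∀ i, connForm i p w = 0 := by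
  refine existsUnique_of_exists_of_unique ?_ ?_
  · obtain ⟨a, ha⟩ := exists_mem_source p
    have hfp : f p.proj ∈ HP.dom a := (triv f a).map_source ha
    let u : S3 := unitOf (p.toHV a)
    let τ : B → InducedBundle f := fun b => (triv f a).symm (b, u)
    have hτp : τ p.proj = p := (triv f a).left_inv ha
    have hτ : MDifferentiableAt (𝓡 m) (PModel m) τ p.proj := by
      have h2 : MDifferentiableAt (PModel m) (PModel m) (triv f a).symm
          (p.proj, u) := mdifferentiableAt_triv_symm hfp
      exact h2.comp p.proj (mdifferentiableAt_id.prodMk mdifferentiableAt_const)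
    let w₀ : TangentSpace (PModel m) p := mfderiv (𝓡 m) (PModel m) τ p.proj v
    have hw0 : dproj p w₀ = v := by
      have h := mfderiv_comp_apply_of_eq p.proj (mdifferentiable_proj p) hτ hτp v
      have hid : proj ∘ τ = id := rfl
      rw [hid, mfderiv_id] at h
      exact h.symm
    choose x hx _ using fun i => existsUnique_vertical i p
    refine ⟨w₀ - ∑ i, connForm i p w₀ • x i, ?_, fun j => ?_⟩
    · rw [map_sub, map_sum, hw0]
      simp [(hx _).1]
    · rw [map_sub, map_sum]
      simp [connForm_vertical _ j p _ (hx _).2]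
  · rintro w₁ w₂ ⟨h1, h1'⟩ ⟨h2, h2'⟩
    have hd : dproj p (w₁ - w₂) = 0 := by rw [map_sub, h1, h2, sub_self]
    have hc : ∀ i, connForm i p (w₁ - w₂) = 0 := fun i => by
      rw [map_sub, h1' i, h2' i, sub_self]
    obtain ⟨q, hq⟩ := dtoHV_of_dproj_eq_zero p _ hd
    have hre : (inner ℝ q 1 : ℝ) = 0 := by
      rw [← inner_smul_toHV p, ← hq, one_smul]
      exact inner_dtoHV_toHV p _
    have him : ∀ i, (inner ℝ (imUnit i) q : ℝ) = 0 := fun i => by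
      have h : inner ℝ (-(imUnit i • p.toHV)) (dtoHV p (w₁ - w₂)) = (0 : ℝ) := hc i
      rw [hq, inner_neg_left, inner_smul_toHV] at h
      linarith
    have hq0 : q = 0 := by
      have h0 := him 0
      have h1 := him 1
      have h2 := him 2
      simp only [inner_quaternion] at hre h0 h1 h2
      simp [imUnit] at hre h0 h1 h2
      ext <;> simp [*]
    exact sub_eq_zero.1 (eq_zero_of_dproj_dtoHV p _ hd (by rw [hq, hq0, zero_smul]))

end Existence

/-- The vertical vector field `ξ_{i+1}` on `P`: at `x` it is `-e_i x`, where `(e_0, e_1, e_2)` is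
`(i, j, k)`. -/
def vert [IsManifold (𝓡 m) ∞ B] (f : C^∞⟮𝓡 m, B; 𝓘(ℝ, Fin n → ℍ[ℝ]), HP n⟯) (i : Fin 3)
    (p : InducedBundle f) : TangentSpace (PModel m) p :=
  (existsUnique_vertical i p).choose

theorem continuous_of_linear (l : EuclideanSpace ℝ (Fin m) →ₗ[ℝ]
    EuclideanSpace ℝ (Fin m) × EuclideanSpace ℝ (Fin 3)) : Continuous l :=
  l.continuous_of_finiteDimensional

/-- The horizontal lift to `T_p P` of tangent vectors of `B`. -/
def hlift [IsManifold (𝓡 m) ∞ B] (p : InducedBundle f) :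
    TangentSpace (𝓡 m) p.proj →L[ℝ] TangentSpace (PModel m) p :=
  let l : TangentSpace (𝓡 m) p.proj →ₗ[ℝ] TangentSpace (PModel m) p :=
    { toFun v := (existsUnique_horizontalLift p v).choose
      map_add' v w := by
        have hv := (existsUnique_horizontalLift p v).choose_spec.1
        have hw := (existsUnique_horizontalLift p w).choose_spec.1
        refine ((existsUnique_horizontalLift p (v + w)).choose_spec.2 _ ⟨?_, fun i => ?_⟩).symm
        · rw [map_add, hv.1, hw.1]
        · rw [map_add, hv.2 i, hw.2 i, add_zero]
      map_smul' c v := by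
        have hv := (existsUnique_horizontalLift p v).choose_spec.1
        refine ((existsUnique_horizontalLift p (c • v)).choose_spec.2 _ ⟨?_, fun i => ?_⟩).symm
        · rw [map_smul, hv.1]; rfl
        · rw [map_smul, hv.2 i, smul_zero] }
  { l with
    cont := continuous_of_linear l }

/-- The horizontal lift `X^*` of a vector field `X` on `B`. -/
def liftField [IsManifold (𝓡 m) ∞ B] (f : C^∞⟮𝓡 m, B; 𝓘(ℝ, Fin n → ℍ[ℝ]), HP n⟯)
    (X : Π b : B, TangentSpace (𝓡 m) b) (p : InducedBundle f) : TangentSpace (PModel m) p :=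
  hlift p (X p.proj)

theorem dproj_hlift [IsManifold (𝓡 m) ∞ B] (p : InducedBundle f)
    (v : TangentSpace (𝓡 m) p.proj) : dproj p (hlift p v) = v :=
  (existsUnique_horizontalLift p v).choose_spec.1.1

theorem connForm_hlift [IsManifold (𝓡 m) ∞ B] (i : Fin 3) (p : InducedBundle f)
    (v : TangentSpace (𝓡 m) p.proj) : connForm i p (hlift p v) = 0 :=
  (existsUnique_horizontalLift p v).choose_spec.1.2 i

theorem dproj_vert [IsManifold (𝓡 m) ∞ B] (i : Fin 3) (p : InducedBundle f) :
    dproj p (vert f i p) = 0 :=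
  (existsUnique_vertical i p).choose_spec.1.1

theorem dtoHV_vert [IsManifold (𝓡 m) ∞ B] (i : Fin 3) (p : InducedBundle f) :
    dtoHV p (vert f i p) = -(imUnit i • p.toHV) :=
  (existsUnique_vertical i p).choose_spec.1.2

end InducedBundle

/-! ### Vector fields, exterior derivative, Sasakian and almost complex structures -/

section Tensors

variable {E : Type*} [NormedAddCommGroup E] [NormedSpace ℝ E] {H : Type*} [TopologicalSpace H]
  (I : ModelWithCorners ℝ E H) {M : Type*} [TopologicalSpace M] [ChartedSpace H M]

/-- The vector field `X` is smooth. -/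
def SmoothField [IsManifold I ∞ M] (X : Π x : M, TangentSpace I x) : Prop :=
  ContMDiff I I.tangent ∞ fun x => (⟨x, X x⟩ : TangentBundle I M)

/-- The one-form `θ` is smooth. -/
def SmoothForm [IsManifold I ∞ M] (θ : Π x : M, TangentSpace I x →L[ℝ] ℝ) : Prop :=
  ContMDiff I (I.prod 𝓘(ℝ, E →L[ℝ] ℝ)) ∞ fun x =>
    Bundle.TotalSpace.mk' (E →L[ℝ] ℝ)
      (E := fun x : M => TangentSpace I x →L[ℝ] Bundle.Trivial M ℝ x) x (θ x)

/-- The field `T` of endomorphisms of the tangent spaces is smooth. -/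
def SmoothEnd [IsManifold I ∞ M] (T : Π x : M, TangentSpace I x →L[ℝ] TangentSpace I x) : Prop :=
  ContMDiff I (I.prod 𝓘(ℝ, E →L[ℝ] E)) ∞ fun x =>
    Bundle.TotalSpace.mk' (E →L[ℝ] E)
      (E := fun x : M => TangentSpace I x →L[ℝ] TangentSpace I x) x (T x)

/-- The exterior derivative of a one-form,
`dθ(X, Y) = X(θ(Y)) - Y(θ(X)) - θ([X, Y])`. -/
def dForm (θ : Π x : M, TangentSpace I x →L[ℝ] ℝ) (X Y : Π x : M, TangentSpace I x) (x : M) : ℝ :=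
  mvfderiv I (fun y => θ y (Y y)) x (X x) - mvfderiv I (fun y => θ y (X y)) x (Y x)
    - θ x (VectorField.mlieBracket I X Y x)

/-- `J` is an integrable almost complex structure: a smooth field of endomorphisms with
`J^2 = -1` whose Nijenhuis tensor
`[J, J](X, Y) = [X, Y] + J[JX, Y] + J[X, JY] - [JX, JY]` vanishes. -/
structure IsIntegrable [IsManifold I ∞ M]
    (J : Π x : M, TangentSpace I x →L[ℝ] TangentSpace I x) : Prop where
  smooth : SmoothEnd I J
  sq_eq_neg : ∀ (x : M) (v : TangentSpace I x), J x (J x v) = -v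
  nijenhuis : ∀ X Y : Π x : M, TangentSpace I x, SmoothField I X → SmoothField I Y → ∀ x : M,
    VectorField.mlieBracket I X Y x
      + J x (VectorField.mlieBracket I (fun y => J y (X y)) Y x)
      + J x (VectorField.mlieBracket I X (fun y => J y (Y y)) x)
      - VectorField.mlieBracket I (fun y => J y (X y)) (fun y => J y (Y y)) x = 0

end Tensors

/-- A Sasakian structure `(φ, ξ, η, g)` on a manifold `B`: a normal contact metric structure.
In terms of the exterior derivative `dForm` the contact condition is `dη(X, Y) = 2 g(X, φ Y)` and
normality is `[φ, φ] + dη ⊗ ξ = 0`; with the other customary exterior derivative of one-forms, which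
is half of `dForm`, these read `dη(X, Y) = g(X, φ Y)` and `[φ, φ] + 2 dη ⊗ ξ = 0`. -/
structure SasakianStructure (m : ℕ) (B : Type*) [TopologicalSpace B]
    [ChartedSpace (EuclideanSpace ℝ (Fin m)) B] [IsManifold (𝓡 m) ∞ B] where
  φ : Π b : B, TangentSpace (𝓡 m) b →L[ℝ] TangentSpace (𝓡 m) b
  ξ : Π b : B, TangentSpace (𝓡 m) b
  η : Π b : B, TangentSpace (𝓡 m) b →L[ℝ] ℝ
  g : Bundle.ContMDiffRiemannianMetric (𝓡 m) ∞ (EuclideanSpace ℝ (Fin m))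
    (fun b : B => TangentSpace (𝓡 m) b)
  smooth_φ : SmoothEnd (𝓡 m) φ
  smooth_ξ : SmoothField (𝓡 m) ξ
  smooth_η : SmoothForm (𝓡 m) η
  η_ξ : ∀ b, η b (ξ b) = 1
  φ_sq : ∀ b v, φ b (φ b v) = -v + η b v • ξ b
  compatible : ∀ b v w, g.inner b (φ b v) (φ b w) = g.inner b v w - η b v * η b w
  contact : ∀ X Y : Π b : B, TangentSpace (𝓡 m) b, SmoothField (𝓡 m) X → SmoothField (𝓡 m) Y →
    ∀ b, dForm (𝓡 m) η X Y b = 2 * g.inner b (X b) (φ b (Y b))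
  normal : ∀ X Y : Π b : B, TangentSpace (𝓡 m) b, SmoothField (𝓡 m) X → SmoothField (𝓡 m) Y →
    ∀ b, φ b (φ b (VectorField.mlieBracket (𝓡 m) X Y b))
      + VectorField.mlieBracket (𝓡 m) (fun c => φ c (X c)) (fun c => φ c (Y c)) b
      - φ b (VectorField.mlieBracket (𝓡 m) (fun c => φ c (X c)) Y b)
      - φ b (VectorField.mlieBracket (𝓡 m) X (fun c => φ c (Y c)) b)
      + dForm (𝓡 m) η X Y b • ξ b = 0

/-! ### The almost Hermitian structure on the induced bundle -/

section Construction

variable [IsManifold (𝓡 m) ∞ B] (f : C^∞⟮𝓡 m, B; 𝓘(ℝ, Fin n → ℍ[ℝ]), HP n⟯)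
  (S : SasakianStructure m B)

open InducedBundle

/-- The metric of `P`, for which `P → B` is a Riemannian submersion onto `(B, g)` with the
horizontal spaces of the induced connection and with fibres isometric to the unit sphere `S^3`. -/
def metricP (p : InducedBundle f) (v : TangentSpace (PModel m) p) :
    TangentSpace (PModel m) p →L[ℝ] ℝ :=
  (S.g.inner p.proj (dproj p v)).comp (dproj p) + ∑ i, connForm i p v • connForm i p

/-- The one-form on `P` dual to `ξ_{i+1}`. -/
def etaHat (i : Fin 3) (p : InducedBundle f) : TangentSpace (PModel m) p →L[ℝ] ℝ :=
  metricP f S p (vert f i p)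

/-- The horizontal lift `ξ^*`. -/
def xiStar : Π p : InducedBundle f, TangentSpace (PModel m) p := liftField f S.ξ

/-- The one-form on `P` dual to `ξ^*`. -/
def etaHatStar (p : InducedBundle f) : TangentSpace (PModel m) p →L[ℝ] ℝ :=
  metricP f S p (xiStar f S p)

/-- The almost complex structure of `P`; by the lemmas below it is determined by
`J ξ₁ = ξ₂`, `J ξ₂ = -ξ₁`, `J ξ₃ = ξ^*`, `J ξ^* = -ξ₃` and `J X^* = (φ X)^*` for `X ⊥ ξ`. -/
def almostComplex (p : InducedBundle f) :
    TangentSpace (PModel m) p →L[ℝ] TangentSpace (PModel m) p :=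
  (etaHat f S 0 p).smulRight (vert f 1 p) - (etaHat f S 1 p).smulRight (vert f 0 p)
    + (etaHat f S 2 p).smulRight (xiStar f S p) - (etaHatStar f S p).smulRight (vert f 2 p)
    + ((hlift p).comp (S.φ p.proj)).comp (dproj p)

theorem phi_xi (b : B) : S.φ b (S.ξ b) = 0 := by
  have h2 : S.φ b (S.φ b (S.ξ b)) = 0 := by rw [S.φ_sq, S.η_ξ, one_smul, neg_add_cancel]
  have h3 := S.φ_sq b (S.φ b (S.ξ b))
  rw [h2, map_zero] at h3
  have h4 : S.φ b (S.ξ b) = S.η b (S.φ b (S.ξ b)) • S.ξ b := by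
    rw [eq_comm, neg_add_eq_zero] at h3
    exact h3
  have h5 : S.η b (S.φ b (S.ξ b)) • S.φ b (S.ξ b) = 0 := by
    rw [← map_smul, ← h4, h2]
  rcases smul_eq_zero.1 h5 with h | h
  · rw [h4, h, zero_smul]
  · exact h

theorem eta_eq (b : B) (v : TangentSpace (𝓡 m) b) : S.η b v = S.g.inner b v (S.ξ b) := by
  have h := S.compatible b v (S.ξ b)
  rw [phi_xi, map_zero, S.η_ξ, mul_one] at h
  linarith

theorem etaHat_eq (i : Fin 3) (p : InducedBundle f) : etaHat f S i p = connForm i p := by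
  ext v
  simp [etaHat, metricP, dproj_vert, connForm_vertical i _ p _ (dtoHV_vert i p)]

theorem etaHatStar_apply (p : InducedBundle f) (v : TangentSpace (PModel m) p) :
    etaHatStar f S p v = S.η p.proj (dproj p v) := by
  rw [eta_eq, S.g.symm]
  simp [etaHatStar, metricP, xiStar, liftField, dproj_hlift, connForm_hlift]

theorem almostComplex_apply (p : InducedBundle f) (v : TangentSpace (PModel m) p) :
    almostComplex f S p v = connForm 0 p v • vert f 1 p - connForm 1 p v • vert f 0 p
      + connForm 2 p v • xiStar f S p - S.η p.proj (dproj p v) • vert f 2 p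
      + hlift p (S.φ p.proj (dproj p v)) := by
  rw [← etaHatStar_apply, ← etaHat_eq f S, ← etaHat_eq f S, ← etaHat_eq f S]
  rfl

theorem almostComplex_vert_zero (p : InducedBundle f) :
    almostComplex f S p (vert f 0 p) = vert f 1 p := by
  simp [almostComplex_apply, dproj_vert, connForm_vertical 0 _ p _ (dtoHV_vert 0 p)]

theorem almostComplex_vert_one (p : InducedBundle f) :
    almostComplex f S p (vert f 1 p) = -vert f 0 p := by
  simp [almostComplex_apply, dproj_vert, connForm_vertical 1 _ p _ (dtoHV_vert 1 p)]

theorem almostComplex_vert_two (p : InducedBundle f) :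
    almostComplex f S p (vert f 2 p) = xiStar f S p := by
  simp [almostComplex_apply, dproj_vert, connForm_vertical 2 _ p _ (dtoHV_vert 2 p)]

theorem almostComplex_xiStar (p : InducedBundle f) :
    almostComplex f S p (xiStar f S p) = -vert f 2 p := by
  simp [almostComplex_apply, xiStar, liftField, dproj_hlift, connForm_hlift, phi_xi, S.η_ξ]

theorem almostComplex_hlift (p : InducedBundle f) (v : TangentSpace (𝓡 m) p.proj)
    (hv : S.g.inner p.proj v (S.ξ p.proj) = 0) :
    almostComplex f S p (hlift p v) = hlift p (S.φ p.proj v) := by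
  simp [almostComplex_apply, dproj_hlift, connForm_hlift, eta_eq, hv]

end Construction

end HopfSasaki

end

open HopfSasaki

/-! The Nijenhuis tensor `N` of `J` is tensorial and skew, and `J² = -1` gives `N(JX, Y) = -J N(X,
Y)`. It therefore vanishes at a point once it vanishes on pairs of smooth fields that generate the
tangent space over the complex numbers. Suitable generators are ξ₁, ξ₃ and the lifts `X^*` with `X ⊥
ξ`, because ξ₂ = Jξ₁ and ξ^* = Jξ₃ (`nijenhuis_eq_zero_of_generators`, `span_complexGenerators`).

Three kinds of brackets enter. The ξᵢ generate left multiplication by unit quaternions, so they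
bracket as in the Lie algebra of S³; in particular [ξ₁, ξ₃] = -2ξ₂ and [ξ₂, ξ₃] = 2ξ₁. The
connection is invariant under this action, so [ξᵢ, X^*] = 0 (`mlieBracket_vert_liftField`). Finally
[X^*, Y^*] projects to [X, Y], and its vertical components are the numbers -dη̂ᵢ(X^*, Y^*)
(`connForm_mlieBracket_liftField`).

Hence N(ξ₁, ξ₃) = -2ξ₂ + 2Jξ₁ = 0, and N(ξ₁, X^*) contains only zero brackets. N(ξ₃, X^*) reduces to
J[ξ^*, X^*] - [ξ^*, (φX)^*]. Condition 2 makes both brackets horizontal, and on a Sasakian manifold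
the flow of ξ preserves φ and the contact distribution, so the difference vanishes.

In N(X^*, Y^*) the horizontal part is the normality identity plus a multiple of ξ^*. Its coefficient
is a sum of two curvature terms that cancel by condition 3 with φX in place of X. The vertical part
cancels by condition 3, except for one contribution -η([φX, Y] + [X, φY]), which is zero by the
contact condition and compatibility of the metric. -/

noncomputable section

namespace HopfSasaki

open Bundle VectorField Filter Topology

/-! ### Lie brackets as commutators of derivatives, and related vector fields. -/

section General

variable {E : Type*} [NormedAddCommGroup E] [NormedSpace ℝ E] {H : Type*} [TopologicalSpace H]
  {I : ModelWithCorners ℝ E H} {M : Type*} [TopologicalSpace M] [ChartedSpace H M]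
  {E' : Type*} [NormedAddCommGroup E'] [NormedSpace ℝ E'] {H' : Type*} [TopologicalSpace H']
  {I' : ModelWithCorners ℝ E' H'} {M' : Type*} [TopologicalSpace M'] [ChartedSpace H' M']
  {E'' : Type*} [NormedAddCommGroup E''] [NormedSpace ℝ E''] {H'' : Type*} [TopologicalSpace H'']
  {J : ModelWithCorners ℝ E'' H''} {N : Type*} [TopologicalSpace N] [ChartedSpace H'' N]
  {F : Type*} [NormedAddCommGroup F] [NormedSpace ℝ F]

/-- Smoothness of the partial derivative of a family of maps, applied to a family of vectors. -/
theorem contMDiffAt_mfderiv_family [IsManifold J ∞ N] [IsManifold I ∞ M] [IsManifold I' ∞ M']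
    {x₀ : N} (f : N → M → M') (g : N → M) (v : Π x : N, TangentSpace I (g x))
    (hf : ContMDiffAt (J.prod I) I' ∞ (Function.uncurry f) (x₀, g x₀))
    (hv : ContMDiffAt J I.tangent ∞ (fun x => (⟨g x, v x⟩ : TangentBundle I M)) x₀) :
    ContMDiffAt J I'.tangent ∞
      (fun x => (⟨f x (g x), mfderiv I I' (f x) (g x) (v x)⟩ : TangentBundle I' M')) x₀ := by
  have hg : ContMDiffAt J I ∞ g x₀ := (contMDiffAt_totalSpace.1 hv).1
  have : IsManifold J 1 N := .of_le (n := ∞) (by simp)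
  have : IsManifold I 1 M := .of_le (n := ∞) (by simp)
  have : IsManifold I' 1 M' := .of_le (n := ∞) (by simp)
  have h1 := ContMDiffAt.mfderiv (m := ∞) f g hf hg (by simp)
  have h2 : ContMDiffAt J I' ∞ (fun x => f x (g x)) x₀ :=
    ContMDiffAt.comp x₀ hf (contMDiffAt_id.prodMk hg)
  exact ContMDiffAt.clm_apply_of_inCoordinates h1 hv h2

/-- Smoothness of the derivative of a vector-valued map along a smooth field. -/
theorem contMDiffAt_mvfderiv_apply [IsManifold I ∞ M] {x₀ : M} {h : M → F}
    {W : Π x : M, TangentSpace I x} (hh : ContMDiffAt I 𝓘(ℝ, F) ∞ h x₀)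
    (hW : ContMDiffAt I I.tangent ∞ (fun x => (⟨x, W x⟩ : TangentBundle I M)) x₀) :
    ContMDiffAt I 𝓘(ℝ, F) ∞ (fun x => mvfderiv I h x (W x)) x₀ := by
  have h1 := contMDiffAt_mfderiv_family (fun _ : M => h) id W
    (ContMDiffAt.comp (x₀, x₀) hh contMDiffAt_snd) hW
  have h2 := (contMDiffAt_totalSpace.1 h1).2
  simpa using! h2

/-- The pullback of a field applies the inverse of the derivative of the inverse chart, which the
chain rule cancels; directional derivatives thus do not change when read in a chart. -/
theorem fderivWithin_comp_extChartAt_symm_mpullbackWithin [IsManifold I ∞ M] {x : M} {k : M → F}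
    {z : E} (U : Π x : M, TangentSpace I x) (hz : z ∈ (extChartAt I x).target)
    (hk : MDifferentiableAt I 𝓘(ℝ, F) k ((extChartAt I x).symm z)) :
    fderivWithin ℝ (k ∘ (extChartAt I x).symm) (Set.range I) z
        (mpullbackWithin 𝓘(ℝ, E) I (extChartAt I x).symm U (Set.range I) z) =
      mvfderiv I k ((extChartAt I x).symm z) (U ((extChartAt I x).symm z)) := by
  have : IsManifold I 1 M := .of_le (n := ∞) (by simp)
  have hs : MDifferentiableWithinAt 𝓘(ℝ, E) I (extChartAt I x).symm (Set.range I) z :=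
    mdifferentiableWithinAt_extChartAt_symm hz
  have hu : UniqueMDiffWithinAt 𝓘(ℝ, E) (Set.range I) z :=
    (I.uniqueDiffOn z (extChartAt_target_subset_range x hz)).uniqueMDiffWithinAt
  have h1 := mfderiv_comp_mfderivWithin z hk hs hu
  rw [mfderivWithin_eq_fderivWithin] at h1
  rw [h1, mpullbackWithin_apply]
  have h2 := isInvertible_mfderivWithin_extChartAt_symm hz
  change mvfderiv I k _ (mfderivWithin 𝓘(ℝ, E) I (extChartAt I x).symm (Set.range I) z
    ((mfderivWithin 𝓘(ℝ, E) I (extChartAt I x).symm (Set.range I) z).inverse _)) = _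
  rw [h2.self_apply_inverse]

/-- The derivative of a function along the Lie bracket of two vector fields is the commutator of
the derivatives. -/
theorem mvfderiv_mlieBracket [CompleteSpace E] [IsManifold I ∞ M] {x : M} {h : M → F}
    {V W : Π x : M, TangentSpace I x} (hh : ContMDiffAt I 𝓘(ℝ, F) ∞ h x)
    (hV : ContMDiffAt I I.tangent ∞ (fun x => (⟨x, V x⟩ : TangentBundle I M)) x)
    (hW : ContMDiffAt I I.tangent ∞ (fun x => (⟨x, W x⟩ : TangentBundle I M)) x) :
    mvfderiv I h x (mlieBracket I V W x) =
      mvfderiv I (fun y => mvfderiv I h y (W y)) x (V x)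
        - mvfderiv I (fun y => mvfderiv I h y (V y)) x (W x) := by
  have : IsManifold I 1 M := .of_le (n := ∞) (by simp)
  set φ := extChartAt I x with hφ
  have hx : φ x ∈ φ.target := mem_extChartAt_target x
  have hxx : φ.symm (φ x) = x := extChartAt_to_inv x
  have hxr : φ x ∈ Set.range I := Set.mem_range_self _
  have hdiff : ∀ {U : Π x : M, TangentSpace I x},
      ContMDiffAt I I.tangent ∞ (fun x => (⟨x, U x⟩ : TangentBundle I M)) x →
      DifferentiableWithinAt ℝ (mpullbackWithin 𝓘(ℝ, E) I φ.symm U (Set.range I))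
        (Set.range I) (φ x) := by
    intro U hU
    have h1 := MDifferentiableWithinAt.differentiableWithinAt_mpullbackWithin_vectorField
      (s := Set.univ) (hU.mdifferentiableAt (by simp)).mdifferentiableWithinAt
    rwa [Set.preimage_univ, Set.univ_inter] at h1
  have hks : ContDiffWithinAt ℝ ∞ (h ∘ φ.symm) (Set.range I) (φ x) := by
    have h1 := (contMDiffAt_iff.1 hh).2
    rwa [extChartAt_model_space_eq_id] at h1
  have hnear : ∀ᶠ z in 𝓝[Set.range I] (φ x), z ∈ φ.target ∧
      MDifferentiableAt I 𝓘(ℝ, F) h (φ.symm z) := by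
    refine Filter.Eventually.and (extChartAt_target_mem_nhdsWithin x) ?_
    -- Smoothness of order ∞ at a point gives, for each finite order, a neighbourhood depending on
    -- that order. The order is lowered to 1 to obtain a single neighbourhood.
    have h1 : ∀ᶠ y in 𝓝 (φ.symm (φ x)), ContMDiffAt I 𝓘(ℝ, F) 1 h y := by
      rw [hxx]
      exact (contMDiffAt_iff_contMDiffAt_nhds (by simp)).1 (hh.of_le ENat.LEInfty.out)
    have h2 := ((continuousAt_extChartAt_symm (I := I) x).continuousWithinAt
      (s := Set.range I)).eventually h1
    exact h2.mono fun z hz => hz.mdifferentiableAt (by simp)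
  have hcomm : ∀ {U U' : Π x : M, TangentSpace I x},
      ContMDiffAt I I.tangent ∞ (fun x => (⟨x, U x⟩ : TangentBundle I M)) x →
      fderivWithin ℝ (fun z => fderivWithin ℝ (h ∘ φ.symm) (Set.range I) z
          (mpullbackWithin 𝓘(ℝ, E) I φ.symm U (Set.range I) z)) (Set.range I) (φ x)
        (mpullbackWithin 𝓘(ℝ, E) I φ.symm U' (Set.range I) (φ x)) =
      mvfderiv I (fun y => mvfderiv I h y (U y)) x (U' x) := by
    intro U U' hU
    have h1 : (fun z => fderivWithin ℝ (h ∘ φ.symm) (Set.range I) z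
          (mpullbackWithin 𝓘(ℝ, E) I φ.symm U (Set.range I) z)) =ᶠ[𝓝[Set.range I] (φ x)]
        (fun y => mvfderiv I h y (U y)) ∘ φ.symm := by
      filter_upwards [hnear] with z hz
      exact fderivWithin_comp_extChartAt_symm_mpullbackWithin U hz.1 hz.2
    rw [h1.fderivWithin_eq_of_mem hxr]
    have h2 := (contMDiffAt_mvfderiv_apply hh hU).mdifferentiableAt (by simp)
    rw [fderivWithin_comp_extChartAt_symm_mpullbackWithin U' hx (by rw [hxx]; exact h2)]
    rw [hxx]
  -- The formula in the model space; it rests on the symmetry of the second derivative.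
  have hb := fderivWithin_apply_lieBracket hks (by simpa using! ENat.LEInfty.out) I.uniqueDiffOn
    (I.range_subset_closure_interior hxr) hxr (hdiff hW) (hdiff hV)
  rw [hcomm hW, hcomm hV] at hb
  rw [← hb]
  have hu : UniqueMDiffWithinAt 𝓘(ℝ, E) (Set.range I) (φ x) :=
    (I.uniqueDiffOn _ hxr).uniqueMDiffWithinAt
  have h1 := mfderiv_comp_mfderivWithin_of_eq (hh.mdifferentiableAt (by simp))
    (mdifferentiableWithinAt_extChartAt_symm hx) hu hxx
  rw [mfderivWithin_eq_fderivWithin] at h1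
  rw [h1]
  have hxs : x ∈ φ.source := mem_extChartAt_source x
  have h2 := mfderiv_extChartAt_comp_mfderivWithin_extChartAt_symm' hxs
  rw [← mlieBracketWithin_univ, mlieBracketWithin_apply, Set.preimage_univ, Set.univ_inter]
  change mvfderiv I h x _ = mvfderiv I h x _
  congr 1
  -- The bracket on the manifold is the chart bracket pulled back by the inverse of the derivative
  -- of the chart; that inverse is the derivative of the inverse chart.
  refine (isInvertible_mfderiv_extChartAt hxs).inverse_apply_eq.2 ?_
  exact (DFunLike.congr_fun h2 _).symm

/-- The Lie bracket of fields that are related by a smooth map to fields on the target is related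
to the Lie bracket of the latter. -/
theorem mfderiv_mlieBracket_of_related [CompleteSpace E] [CompleteSpace E'] [IsManifold I ∞ M]
    [IsManifold I' ∞ M'] {G : M → M'} {V W : Π x : M, TangentSpace I x}
    {V' W' : Π y : M', TangentSpace I' y} (x : M) (hG : ContMDiff I I' ∞ G)
    (hV : SmoothField I V) (hW : SmoothField I W) (hV' : SmoothField I' V')
    (hW' : SmoothField I' W') (hVV' : ∀ x, mfderiv I I' G x (V x) = V' (G x))
    (hWW' : ∀ x, mfderiv I I' G x (W x) = W' (G x)) :
    mfderiv I I' G x (mlieBracket I V W x) = mlieBracket I' V' W' (G x) := by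
  have : IsManifold I' 1 M' := .of_le (n := ∞) (by simp)
  set ψ := extChartAt I' (G x) with hψ
  have hψs : ContMDiffAt I' 𝓘(ℝ, E') ∞ ψ (G x) := contMDiffAt_extChartAt
  -- A chart is a vector-valued function that separates tangent vectors, so the two brackets may be
  -- compared through commutators of derivatives of ψ.
  have hinj : Function.Injective (mvfderiv I' ψ (G x)) := by
    obtain ⟨e, he⟩ := isInvertible_mfderiv_extChartAt (I := I') (mem_extChartAt_source (I := I') (G x))
    have : (mvfderiv I' ψ (G x) : TangentSpace I' (G x) → E') = e := by
      funext v
      exact (DFunLike.congr_fun he v).symm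
    rw [this]
    exact e.injective
  apply hinj
  have hev : ∀ᶠ y in 𝓝 x, MDifferentiableAt I' 𝓘(ℝ, E') ψ (G y) := by
    have h1 : ∀ᶠ y in 𝓝 (G x), ContMDiffAt I' 𝓘(ℝ, E') 1 ψ y :=
      (contMDiffAt_iff_contMDiffAt_nhds (by simp)).1 (hψs.of_le ENat.LEInfty.out)
    exact (hG.continuous.continuousAt.eventually h1).mono fun z hz =>
      hz.mdifferentiableAt (by simp)
  have hGd : ∀ y, MDifferentiableAt I I' G y := fun y => hG.contMDiffAt.mdifferentiableAt (by simp)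
  have hrel : ∀ {U : Π x : M, TangentSpace I x} {U' : Π y : M', TangentSpace I' y},
      (∀ x, mfderiv I I' G x (U x) = U' (G x)) →
      (fun y => mvfderiv I (ψ ∘ G) y (U y)) =ᶠ[𝓝 x] (fun z => mvfderiv I' ψ z (U' z)) ∘ G := by
    intro U U' hU
    filter_upwards [hev] with y hy
    have h1 : mvfderiv I (ψ ∘ G) y (U y) = mvfderiv I' ψ (G y) (mfderiv I I' G y (U y)) :=
      mfderiv_comp_apply y hy (hGd y) (U y)
    rw [h1, hU]
    rfl
  have hcomm : ∀ {U T : Π x : M, TangentSpace I x} {U' T' : Π y : M', TangentSpace I' y},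
      (∀ x, mfderiv I I' G x (U x) = U' (G x)) → (∀ x, mfderiv I I' G x (T x) = T' (G x)) →
      SmoothField I' U' →
      mvfderiv I (fun y => mvfderiv I (ψ ∘ G) y (U y)) x (T x) =
        mvfderiv I' (fun z => mvfderiv I' ψ z (U' z)) (G x) (T' (G x)) := by
    intro U T U' T' hU hT hU'
    have h1 := (hrel hU).mfderiv_eq (I := I) (I' := 𝓘(ℝ, E'))
    have h2 := (contMDiffAt_mvfderiv_apply hψs hU'.contMDiffAt).mdifferentiableAt (by simp)
    have h3 := mfderiv_comp_apply x h2 (hGd x) (T x)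
    rw [hT, ← h1] at h3
    exact h3
  have h0 : mvfderiv I (ψ ∘ G) x (mlieBracket I V W x) =
      mvfderiv I' ψ (G x) (mfderiv I I' G x (mlieBracket I V W x)) :=
    mfderiv_comp_apply x (hev.self_of_nhds) (hGd x) _
  rw [← h0, mvfderiv_mlieBracket (ContMDiffAt.comp x hψs hG.contMDiffAt) hV.contMDiffAt
    hW.contMDiffAt, mvfderiv_mlieBracket hψs hV'.contMDiffAt hW'.contMDiffAt,
    hcomm hWW' hVV' hW', hcomm hVV' hWW' hV']

end General

/-! ### Smooth endomorphism fields and the tensor calculus of the Nijenhuis tensor. -/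

section General

variable {E : Type*} [NormedAddCommGroup E] [NormedSpace ℝ E] {H : Type*} [TopologicalSpace H]
  {I : ModelWithCorners ℝ E H} {M : Type*} [TopologicalSpace M] [ChartedSpace H M]

/-- A map into a space of continuous linear maps is smooth if its values at fixed vectors are. -/
theorem contMDiffAt_clm_of_apply [FiniteDimensional ℝ E] {F : Type*} [NormedAddCommGroup F]
    [NormedSpace ℝ F] [FiniteDimensional ℝ F] {T : M → E →L[ℝ] F} {x : M}
    (h : ∀ e, ContMDiffAt I 𝓘(ℝ, F) ∞ (fun y => T y e) x) :
    ContMDiffAt I 𝓘(ℝ, E →L[ℝ] F) ∞ T x := by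
  let b := Module.finBasis ℝ E
  let l : (Fin (Module.finrank ℝ E) → F) →ₗ[ℝ] E →L[ℝ] F :=
    (LinearMap.toContinuousLinearMap.toLinearMap).comp (b.constr ℝ).toLinearMap
  let L := LinearMap.toContinuousLinearMap l
  have h1 : ContMDiffAt I 𝓘(ℝ, Fin (Module.finrank ℝ E) → F) ∞ (fun y i => T y (b i)) x :=
    contMDiffAt_pi_space.2 fun i => h (b i)
  have h2 := (L.contDiff (n := ∞)).contMDiff.contMDiffAt.comp x h1
  refine h2.congr_of_eventuallyEq (Eventually.of_forall fun y => ?_)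
  refine ContinuousLinearMap.coe_injective (b.ext fun i => ?_)
  simp [L, l]

/-- A field of endomorphisms is smooth if it maps smooth vector fields to smooth vector fields. -/
theorem smoothEnd_of_apply [FiniteDimensional ℝ E] [IsManifold I ∞ M]
    {T : Π x : M, TangentSpace I x →L[ℝ] TangentSpace I x}
    (h : ∀ (x : M) (W : Π x : M, TangentSpace I x),
      ContMDiffAt I I.tangent ∞ (fun y => (⟨y, W y⟩ : TangentBundle I M)) x →
      ContMDiffAt I I.tangent ∞ (fun y => (⟨y, T y (W y)⟩ : TangentBundle I M)) x) :
    SmoothEnd I T := by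
  have : IsManifold I 1 M := .of_le (n := ∞) (by simp)
  intro x
  refine (contMDiffAt_hom_bundle _).2 ⟨contMDiffAt_id, contMDiffAt_clm_of_apply fun e => ?_⟩
  set t := trivializationAt E (TangentSpace I) x with ht
  have hx : x ∈ t.baseSet := mem_baseSet_trivializationAt _ _ x
  -- The test field is constant in the trivialization at `x`. It is only needed near `x`, which is
  -- why the hypothesis asks for smoothness at one point.
  have h1 : ContMDiffAt I I.tangent ∞ (fun y => (⟨y, t.symmL ℝ y e⟩ : TangentBundle I M)) x := by
    refine (Bundle.contMDiffAt_section _ ).2 ?_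
    refine (contMDiffAt_const (c := e)).congr_of_eventuallyEq ?_
    filter_upwards [t.open_baseSet.mem_nhds hx] with y hy
    rw [Trivialization.symmL_apply _ hy]
    exact congrArg Prod.snd (t.apply_mk_symm hy e)
  have h2 := (contMDiffAt_totalSpace.1 (h x _ h1)).2
  refine h2.congr_of_eventuallyEq ?_
  filter_upwards [t.open_baseSet.mem_nhds hx] with y hy
  rw [ContinuousLinearMap.inCoordinates]
  simp only [ContinuousLinearMap.comp_apply]
  rw [Trivialization.continuousLinearMapAt_apply, t.coe_linearMapAt_of_mem hy]

theorem SmoothEnd.apply_contMDiffAt [IsManifold I ∞ M]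
    {T : Π x : M, TangentSpace I x →L[ℝ] TangentSpace I x} (hT : SmoothEnd I T) {x : M}
    {W : Π x : M, TangentSpace I x}
    (hW : ContMDiffAt I I.tangent ∞ (fun y => (⟨y, W y⟩ : TangentBundle I M)) x) :
    ContMDiffAt I I.tangent ∞ (fun y => (⟨y, T y (W y)⟩ : TangentBundle I M)) x :=
  ContMDiffAt.clm_bundle_apply (hT x) hW

theorem SmoothEnd.apply [IsManifold I ∞ M]
    {T : Π x : M, TangentSpace I x →L[ℝ] TangentSpace I x} (hT : SmoothEnd I T)
    {W : Π x : M, TangentSpace I x} (hW : SmoothField I W) :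
    SmoothField I fun y => T y (W y) := fun x => hT.apply_contMDiffAt (hW x)

theorem SmoothEnd.apply_mdifferentiableAt [IsManifold I ∞ M]
    {T : Π x : M, TangentSpace I x →L[ℝ] TangentSpace I x} (hT : SmoothEnd I T) {x : M}
    {W : Π x : M, TangentSpace I x}
    (hW : MDifferentiableAt I I.tangent (fun y => (⟨y, W y⟩ : TangentBundle I M)) x) :
    MDifferentiableAt I I.tangent (fun y => (⟨y, T y (W y)⟩ : TangentBundle I M)) x :=
  have : IsManifold I 1 M := .of_le (n := ∞) (by simp)
  MDifferentiableAt.clm_bundle_apply ((hT x).mdifferentiableAt (by simp)) hW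

/-- Every tangent vector extends to a smooth vector field. -/
theorem exists_smoothField_eq [FiniteDimensional ℝ E] [T2Space M] [IsManifold I ∞ M] (x : M)
    (v : TangentSpace I x) : ∃ X : Π x : M, TangentSpace I x, SmoothField I X ∧ X x = v := by
  have : IsManifold I 1 M := .of_le (n := ∞) (by simp)
  obtain ⟨s, hs, hX⟩ := FiberBundle.exists_contMDiffOn_extend (k := ∞) I E v
  obtain ⟨u, hu, huo, hxu⟩ := mem_nhds_iff.1 hs
  -- A bump function equal to 1 at `x`, with closed support inside the set where the local extension
  -- is smooth.
  obtain ⟨f, hf, -⟩ := (SmoothBumpFunction.nhds_basis_support (I := I)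
    (huo.mem_nhds hxu)).mem_iff.1 (huo.mem_nhds hxu)
  refine ⟨fun y => f y • FiberBundle.extend E v y, ?_, by simp⟩
  exact ContMDiffOn.smul_section_of_tsupport f.contMDiff.contMDiffOn huo hf (hX.mono hu)

variable (I) in
/-- The Nijenhuis tensor of a field of endomorphisms on vector fields. -/
def nijenhuis (J : Π x : M, TangentSpace I x →L[ℝ] TangentSpace I x)
    (X Y : Π x : M, TangentSpace I x) (x : M) : TangentSpace I x :=
  mlieBracket I X Y x + J x (mlieBracket I (fun y => J y (X y)) Y x)
    + J x (mlieBracket I X (fun y => J y (Y y)) x)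
    - mlieBracket I (fun y => J y (X y)) (fun y => J y (Y y)) x

theorem nijenhuis_swap (J : Π x : M, TangentSpace I x →L[ℝ] TangentSpace I x)
    (X Y : Π x : M, TangentSpace I x) (x : M) : nijenhuis I J X Y x = -nijenhuis I J Y X x := by
  simp only [nijenhuis]
  rw [mlieBracket_swap_apply (V := X) (W := Y), mlieBracket_swap_apply (W := Y),
    mlieBracket_swap_apply (V := X), mlieBracket_swap_apply (V := fun y => J y (X y))]
  simp only [map_neg]
  abel

/-- Replacing `X` by `fX` produces the extra terms -Y(f)X, -Y(f)J²X, -(JY)(f)JX and (JY)(f)JX. The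
first two cancel because `J² = -1`, the last two cancel directly. -/
theorem tensorialAt_nijenhuis [CompleteSpace E] [IsManifold I ∞ M]
    {J : Π x : M, TangentSpace I x →L[ℝ] TangentSpace I x} (hJ : SmoothEnd I J)
    (hJ2 : ∀ x v, J x (J x v) = -v) (x : M)
    (Y : Π x : M, TangentSpace I x) :
    TensorialAt I E (fun X => nijenhuis I J X Y x) x where
  smul := by
    intro f X hf hX
    have h1 : (fun y => J y ((f • X) y)) = f • fun y => J y (X y) := by
      funext y; simp
    have hJX := hJ.apply_mdifferentiableAt hX
    simp only [nijenhuis]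
    rw [h1, mlieBracket_smul_left hf hX, mlieBracket_smul_left hf hX,
      mlieBracket_smul_left hf hJX, mlieBracket_smul_left hf hJX]
    simp only [map_add, map_smul, map_neg, neg_smul, hJ2, smul_neg, smul_add, smul_sub]
    abel
  add := by
    intro X X' hX hX'
    have h1 : (fun y => J y ((X + X') y)) = (fun y => J y (X y)) + fun y => J y (X' y) := by
      funext y; simp
    have hJX := hJ.apply_mdifferentiableAt hX
    have hJX' := hJ.apply_mdifferentiableAt hX'
    simp only [nijenhuis]
    rw [h1, mlieBracket_add_left hX hX', mlieBracket_add_left hX hX',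
      mlieBracket_add_left hJX hJX', mlieBracket_add_left hJX hJX']
    simp only [map_add]
    abel

theorem exists_bilinear_eq_nijenhuis [FiniteDimensional ℝ E] [IsManifold I ∞ M]
    {J : Π x : M, TangentSpace I x →L[ℝ] TangentSpace I x} (hJ : SmoothEnd I J)
    (hJ2 : ∀ x v, J x (J x v) = -v) (x : M) :
    ∃ N : TangentSpace I x →L[ℝ] TangentSpace I x →L[ℝ] TangentSpace I x,
      ∀ X Y : Π x : M, TangentSpace I x, SmoothField I X → SmoothField I Y →
        N (X x) (Y x) = nijenhuis I J X Y x := by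
  have : IsManifold I 1 M := .of_le (n := ∞) (by simp)
  have : CompleteSpace E := FiniteDimensional.complete ℝ E
  have h1 : ∀ Y, MDifferentiableAt I I.tangent (fun y => (⟨y, Y y⟩ : TangentBundle I M)) x →
      TensorialAt I E (fun X => nijenhuis I J X Y x) x := fun Y _ =>
    tensorialAt_nijenhuis hJ hJ2 x Y
  have h2 : ∀ X, MDifferentiableAt I I.tangent (fun y => (⟨y, X y⟩ : TangentBundle I M)) x →
      TensorialAt I E (fun Y => nijenhuis I J X Y x) x := fun X hX =>
    { smul := fun hf hY => by
        simp only [nijenhuis_swap J X]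
        rw [(h1 X hX).smul hf hY, smul_neg]
      add := fun hY hY' => by
        simp only [nijenhuis_swap J X]
        rw [(h1 X hX).add hY hY', neg_add] }
  refine ⟨TensorialAt.mkHom₂ (fun X Y => nijenhuis I J X Y x) x h1 h2, fun X Y hX hY => ?_⟩
  exact TensorialAt.mkHom₂_apply h1 h2 ((hX x).mdifferentiableAt (by simp))
    ((hY x).mdifferentiableAt (by simp))

/-- Conjugate linearity: since `J² = -1`, the substitution permutes the four terms up to a factor
`-J`. Hence one vector of each pair `v`, `Jv` is enough for testing. -/
theorem nijenhuis_apply_left [CompleteSpace E] [IsManifold I ∞ M]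
    {J : Π x : M, TangentSpace I x →L[ℝ] TangentSpace I x}
    (hJ2 : ∀ x v, J x (J x v) = -v) (x : M)
    {X Y : Π x : M, TangentSpace I x} (hX : SmoothField I X) :
    nijenhuis I J (fun y => J y (X y)) Y x = -J x (nijenhuis I J X Y x) := by
  have h1 : (fun y => J y (J y (X y))) = (-1 : ℝ) • X := by
    funext y; simp [hJ2]
  have hXd := (hX x).mdifferentiableAt (show (∞ : WithTop ℕ∞) ≠ 0 by simp)
  simp only [nijenhuis]
  rw [h1, mlieBracket_const_smul_left hXd, mlieBracket_const_smul_left hXd]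
  rw [(J x).map_smul]
  simp only [map_add, map_sub, neg_smul, one_smul, hJ2]
  abel

/-- The Nijenhuis tensor is determined by its values on vectors that generate the tangent space
as a complex vector space. -/
theorem nijenhuis_eq_zero_of_generators [FiniteDimensional ℝ E] [T2Space M] [IsManifold I ∞ M]
    {J : Π x : M, TangentSpace I x →L[ℝ] TangentSpace I x} (hJ : SmoothEnd I J)
    (hJ2 : ∀ x v, J x (J x v) = -v) (x : M) (G : Set (Π x : M, TangentSpace I x))
    (hG : ∀ X ∈ G, SmoothField I X)
    (hspan : Submodule.span ℝ ((fun X => X x) '' G ∪ (fun X => J x (X x)) '' G) = ⊤)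
    (h0 : ∀ X ∈ G, ∀ Y ∈ G, nijenhuis I J X Y x = 0)
    {X Y : Π x : M, TangentSpace I x} (hX : SmoothField I X) (hY : SmoothField I Y) :
    nijenhuis I J X Y x = 0 := by
  have : CompleteSpace E := FiniteDimensional.complete ℝ E
  obtain ⟨N, hN⟩ := exists_bilinear_eq_nijenhuis hJ hJ2 x
  have hJN : ∀ v w, N (J x v) w = -J x (N v w) := by
    intro v w
    obtain ⟨X, hX, rfl⟩ := exists_smoothField_eq x v
    obtain ⟨Y, hY, rfl⟩ := exists_smoothField_eq x w
    rw [hN X Y hX hY, hN _ Y (hJ.apply hX) hY, nijenhuis_apply_left hJ2 x hX]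
  have hswap : ∀ v w, N v w = -N w v := by
    intro v w
    obtain ⟨X, hX, rfl⟩ := exists_smoothField_eq x v
    obtain ⟨Y, hY, rfl⟩ := exists_smoothField_eq x w
    rw [hN X Y hX hY, hN Y X hY hX, nijenhuis_swap]
  -- An induction principle: a property stable under linear combinations and `J` holds everywhere
  -- once it holds on the generators. It is used for one slot of the tensor with the other fixed.
  have key : ∀ (P : TangentSpace I x → Prop), (∀ X ∈ G, P (X x)) → (∀ v, P v → P (J x v)) →
      P 0 → (∀ v w, P v → P w → P (v + w)) → (∀ (c : ℝ) v, P v → P (c • v)) → ∀ v, P v := by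
    intro P h1 h2 h3 h4 h5 v
    have hv : v ∈ Submodule.span ℝ ((fun X => X x) '' G ∪ (fun X => J x (X x)) '' G) := by
      rw [hspan]; trivial
    induction hv using Submodule.span_induction with
    | mem v hv =>
      rcases hv with ⟨X, hX, rfl⟩ | ⟨X, hX, rfl⟩
      · exact h1 X hX
      · exact h2 _ (h1 X hX)
    | zero => exact h3
    | add v w _ _ hv hw => exact h4 v w hv hw
    | smul c v _ hv => exact h5 c v hv
  have hleft : ∀ X ∈ G, ∀ w, N w (X x) = 0 := by
    intro X hX
    refine key _ (fun Y hY => by rw [hN Y X (hG Y hY) (hG X hX), h0 Y hY X hX]) ?_ (by simp) ?_ ?_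
    · intro v hv; rw [hJN, hv, map_zero, neg_zero]
    · intro v w hv hw; rw [map_add, add_apply, hv, hw, add_zero]
    · intro c v hv; rw [map_smul, smul_apply, hv, smul_zero]
  have hall : ∀ w v, N v w = 0 := by
    intro w
    refine key (fun v => N v w = 0) (fun X hX => by rw [hswap, hleft X hX, neg_zero]) ?_ (by simp)
      ?_ ?_
    · intro v hv; rw [hJN, hv, map_zero, neg_zero]
    · intro v w hv hw; rw [map_add, add_apply, hv, hw, add_zero]
    · intro c v hv; rw [map_smul, smul_apply, hv, smul_zero]
  rw [← hN X Y hX hY, hall]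

end General

variable {m n : ℕ} {B : Type*} [TopologicalSpace B] [ChartedSpace (EuclideanSpace ℝ (Fin m)) B]

/-! ### Smoothness of the vertical fields through their flows. -/

namespace InducedBundle

variable {f : C^∞⟮𝓡 m, B; 𝓘(ℝ, Fin n → ℍ[ℝ]), HP n⟯}

instance [T2Space B] : T2Space (InducedBundle f) :=
  inferInstanceAs (T2Space {p : B × HSphere n // f p.1 = hopf p.2})

theorem unitOf_mul {c q : ℍ[ℝ]} (hc : ‖c‖ = 1) (hq : q ≠ 0) :
    (unitOf (c * q)).1 = c * (unitOf q).1 := by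
  have hc0 : c ≠ 0 := by rintro rfl; simp at hc
  rw [unitOf_coe (mul_ne_zero hc0 hq), unitOf_coe hq, norm_mul, hc, one_mul, mul_smul_comm]

theorem toHV_eq_unitOf_smul {a : Fin (n + 1)} {p : InducedBundle f} (hp : p.toHV a ≠ 0) :
    p.toHV = (unitOf (p.toHV a)).1 • (unitSec a (f p.proj)).1 :=
  (congrArg (fun q : InducedBundle f => q.toHV) ((triv f a).left_inv hp)).symm

/-- The quaternion is exp(-t eᵢ), the one-parameter group whose left multiplication has velocity -eᵢ
x at time 0. -/
theorem norm_cos_sub_sin_smul_imUnit (i : Fin 3) (t : ℝ) :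
    ‖((Real.cos t : ℝ) : ℍ[ℝ]) - Real.sin t • imUnit i‖ = 1 := by
  have h : ‖((Real.cos t : ℝ) : ℍ[ℝ]) - Real.sin t • imUnit i‖ ^ 2 = 1 := by
    have h1 := Real.cos_sq_add_sin_sq t
    rw [← real_inner_self_eq_norm_sq, inner_quaternion]
    simp only [Quaternion.re_sub, Quaternion.imI_sub, Quaternion.imJ_sub, Quaternion.imK_sub,
      Quaternion.re_smul, Quaternion.imI_smul, Quaternion.imJ_smul, Quaternion.imK_smul,
      Quaternion.re_coe, Quaternion.imI_coe, Quaternion.imJ_coe, Quaternion.imK_coe]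
    fin_cases i <;> simp [imUnit] <;> linarith
  exact (pow_eq_one_iff_of_nonneg (norm_nonneg _) two_ne_zero).1 h

/-- The flow of `ξ_{i+1}` in a local trivialization. -/
def vertFlow (f : C^∞⟮𝓡 m, B; 𝓘(ℝ, Fin n → ℍ[ℝ]), HP n⟯) (a : Fin (n + 1)) (i : Fin 3)
    (p : InducedBundle f) (t : ℝ) : InducedBundle f :=
  (triv f a).symm (p.proj,
    unitOf ((((Real.cos t : ℝ) : ℍ[ℝ]) - Real.sin t • imUnit i) * p.toHV a))

/-- Normalization of quaternions commutes with left multiplication by unit quaternions, so moving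
the fibre coordinate is the same as multiplying the point of the sphere. -/
theorem toHV_vertFlow {a : Fin (n + 1)} (i : Fin 3) {p : InducedBundle f} (hp : p.toHV a ≠ 0)
    (t : ℝ) : (vertFlow f a i p t).toHV =
      (((Real.cos t : ℝ) : ℍ[ℝ]) - Real.sin t • imUnit i) • p.toHV := by
  conv_rhs => rw [toHV_eq_unitOf_smul hp, smul_smul]
  rw [← unitOf_mul (norm_cos_sub_sin_smul_imUnit i t) hp]
  rfl

theorem vertFlow_zero {a : Fin (n + 1)} (i : Fin 3) {p : InducedBundle f} (hp : p.toHV a ≠ 0) :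
    vertFlow f a i p 0 = p := by
  refine Subtype.ext (Prod.ext rfl (Subtype.ext ?_))
  refine (toHV_vertFlow i hp 0).trans ?_
  simp only [Real.cos_zero, Real.sin_zero, zero_smul, sub_zero, Quaternion.coe_one, one_smul]
  rfl

variable [IsManifold (𝓡 m) ∞ B]

theorem contMDiffAt_vertFlow {a : Fin (n + 1)} (i : Fin 3) {p : InducedBundle f}
    (hp : p.toHV a ≠ 0) :
    ContMDiffAt ((PModel m).prod 𝓘(ℝ, ℝ)) (PModel m) ∞ (Function.uncurry (vertFlow f a i))
      (p, 0) := by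
  have hfp : f p.proj ∈ HP.dom a := (triv f a).map_source hp
  have hc : ContDiff ℝ ∞ fun t : ℝ => ((Real.cos t : ℝ) : ℍ[ℝ]) - Real.sin t • imUnit i := by
    have h1 : ContDiff ℝ ∞ fun t : ℝ => ((Real.cos t : ℝ) : ℍ[ℝ]) := by
      have : (fun t : ℝ => ((Real.cos t : ℝ) : ℍ[ℝ])) = fun t => Real.cos t • (1 : ℍ[ℝ]) := by
        funext t; rw [← Quaternion.coe_mul_eq_smul, mul_one]
      rw [this]
      exact Real.contDiff_cos.smul contDiff_const
    exact h1.sub (Real.contDiff_sin.smul contDiff_const)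
  have hL : ContDiff ℝ ∞ fun v : HV n => v a := contDiff_piLp_apply 2
  have h1 : ContMDiffAt ((PModel m).prod 𝓘(ℝ, ℝ)) 𝓘(ℝ, ℍ[ℝ]) ∞
      (fun y : InducedBundle f × ℝ =>
        (((Real.cos y.2 : ℝ) : ℍ[ℝ]) - Real.sin y.2 • imUnit i) * y.1.toHV a) (p, 0) := by
    have h2 : ContMDiff ((PModel m).prod 𝓘(ℝ, ℝ)) 𝓘(ℝ, ℍ[ℝ]) ∞
        (fun y : InducedBundle f × ℝ => ((Real.cos y.2 : ℝ) : ℍ[ℝ]) - Real.sin y.2 • imUnit i) :=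
      hc.contMDiff.comp contMDiff_snd
    have h3 : ContMDiff ((PModel m).prod 𝓘(ℝ, ℝ)) 𝓘(ℝ, ℍ[ℝ]) ∞
        (fun y : InducedBundle f × ℝ => y.1.toHV a) :=
      hL.contMDiff.comp (contMDiff_toHV.comp contMDiff_fst)
    have h5 : ContDiff ℝ ∞ fun q : ℍ[ℝ] × ℍ[ℝ] => q.1 * q.2 := contDiff_fst.mul contDiff_snd
    exact (h5.contMDiff.comp (h2.prodMk_space h3)).contMDiffAt
  have hne : (((Real.cos (0 : ℝ) : ℝ) : ℍ[ℝ]) - Real.sin (0 : ℝ) • imUnit i) * p.toHV a ≠ 0 := by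
    simpa using hp
  have h4 : ContMDiffAt ((PModel m).prod 𝓘(ℝ, ℝ)) (PModel m) ∞
      (fun y : InducedBundle f × ℝ => ((y.1.proj,
        unitOf ((((Real.cos y.2 : ℝ) : ℍ[ℝ]) - Real.sin y.2 • imUnit i) * y.1.toHV a)) : B × S3))
      (p, 0) :=
    (contMDiff_proj.comp contMDiff_fst).contMDiffAt.prodMk
      (ContMDiffAt.comp (p, (0 : ℝ))
        (contMDiffOn_unitOf.contMDiffAt (isOpen_compl_singleton.mem_nhds hne)) h1)
  exact ContMDiffAt.comp (p, (0 : ℝ))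
    ((contMDiffOn_triv_symm (f := f) a).contMDiffAt ((triv f a).open_target.mem_nhds hfp)) h4

/-- The flow at time 0 equals the starting point only propositionally. Equality in the total space
of the tangent bundle avoids transporting vectors along that equation. -/
theorem mk_eq_mk_vert {i : Fin 3} {p q : InducedBundle f} (h : q = p)
    (w : TangentSpace (PModel m) q) (h1 : dproj q w = 0)
    (h2 : dtoHV q w = -(imUnit i • q.toHV)) :
    (⟨q, w⟩ : TangentBundle (PModel m) (InducedBundle f)) = ⟨p, vert f i p⟩ := by
  subst h
  rw [(existsUnique_vertical i q).unique ⟨h1, h2⟩ ⟨dproj_vert i q, dtoHV_vert i q⟩]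

/-- The field, chosen pointwise by uniqueness, is the time derivative at 0 of a jointly smooth local
flow. -/
theorem smoothField_vert (i : Fin 3) : SmoothField (PModel m) (vert f i) := by
  intro p
  obtain ⟨a, ha⟩ := exists_mem_source p
  have h0 := contMDiffAt_mfderiv_family (I := 𝓘(ℝ, ℝ)) (I' := PModel m) (J := PModel m)
    (vertFlow f a i) (fun _ => (0 : ℝ)) (fun _ => (1 : ℝ)) (x₀ := p) (contMDiffAt_vertFlow i ha)
    contMDiffAt_const
  refine h0.congr_of_eventuallyEq ?_
  filter_upwards [(triv f a).open_source.mem_nhds ha] with q hq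
  have hq : q.toHV a ≠ 0 := hq
  have hq0 := vertFlow_zero i hq
  have hγ : MDifferentiableAt 𝓘(ℝ, ℝ) (PModel m) (vertFlow f a i q) 0 := by
    have h1 : ContMDiffAt 𝓘(ℝ, ℝ) (PModel m) ∞ (vertFlow f a i q) 0 :=
      ContMDiffAt.comp (f := fun t : ℝ => (q, t)) (0 : ℝ) (contMDiffAt_vertFlow i hq) (contMDiffAt_const.prodMk contMDiffAt_id)
    exact h1.mdifferentiableAt (by simp)
  refine (mk_eq_mk_vert hq0 _ ?_ ?_).symm
  · have h := mfderiv_comp_apply (0 : ℝ) (mdifferentiable_proj (vertFlow f a i q 0)) hγ (1 : ℝ)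
    have hproj : proj ∘ (vertFlow f a i q) = fun _ => q.proj := rfl
    rw [hproj, mfderiv_const] at h
    exact h.symm
  · have h := mfderiv_comp_apply (0 : ℝ) (mdifferentiable_toHV (vertFlow f a i q 0)) hγ (1 : ℝ)
    have e : toHV ∘ vertFlow f a i q =
        fun t => Real.cos t • q.toHV - Real.sin t • (imUnit i • q.toHV) := by
      funext t
      refine (toHV_vertFlow i hq t).trans ?_
      rw [sub_smul, smul_assoc]
      congr 1
      ext1 k
      exact Quaternion.coe_mul_eq_smul _ _
    have hd : HasDerivAt (toHV ∘ vertFlow f a i q) (-(imUnit i • q.toHV)) 0 := by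
      rw [e]
      have h1 := ((Real.hasDerivAt_cos 0).smul_const q.toHV).sub
        ((Real.hasDerivAt_sin 0).smul_const (imUnit i • q.toHV))
      exact h1.congr_deriv (by simp)
    rw [mfderiv_eq_fderiv, hd.hasFDerivAt.fderiv] at h
    rw [hq0] at h ⊢
    refine Eq.trans (Eq.symm h) ?_
    exact one_smul ℝ (-(imUnit i • q.toHV))

end InducedBundle

/-! ### Smoothness of endomorphisms and forms along maps, and of inner products. -/

section General

variable {E : Type*} [NormedAddCommGroup E] [NormedSpace ℝ E] {H : Type*} [TopologicalSpace H]
  {I : ModelWithCorners ℝ E H} {M : Type*} [TopologicalSpace M] [ChartedSpace H M]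
  {E' : Type*} [NormedAddCommGroup E'] [NormedSpace ℝ E'] {H' : Type*} [TopologicalSpace H']
  {J : ModelWithCorners ℝ E' H'} {N : Type*} [TopologicalSpace N] [ChartedSpace H' N]

/-- This version along a map `b` serves tensors of `B` that are evaluated on projections of vectors
of `P`. -/
theorem SmoothEnd.contMDiffAt_apply [IsManifold I ∞ M]
    {T : Π x : M, TangentSpace I x →L[ℝ] TangentSpace I x} (hT : SmoothEnd I T) {b : N → M}
    {v : Π y : N, TangentSpace I (b y)} {y : N} (hb : ContMDiffAt J I ∞ b y)
    (hv : ContMDiffAt J I.tangent ∞ (fun y => (⟨b y, v y⟩ : TangentBundle I M)) y) :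
    ContMDiffAt J I.tangent ∞ (fun y => (⟨b y, T (b y) (v y)⟩ : TangentBundle I M)) y :=
  ContMDiffAt.clm_bundle_apply (b := b) (ϕ := fun y => T (b y))
    (ContMDiffAt.comp y (hT (b y)) hb) hv

theorem SmoothForm.contMDiffAt_apply [IsManifold I ∞ M]
    {θ : Π x : M, TangentSpace I x →L[ℝ] ℝ} (hθ : SmoothForm I θ) {b : N → M}
    {v : Π y : N, TangentSpace I (b y)} {y : N} (hb : ContMDiffAt J I ∞ b y)
    (hv : ContMDiffAt J I.tangent ∞ (fun y => (⟨b y, v y⟩ : TangentBundle I M)) y) :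
    ContMDiffAt J 𝓘(ℝ, ℝ) ∞ (fun y => θ (b y) (v y)) y := by
  have h1 := ContMDiffAt.clm_bundle_apply (b := b) (ϕ := fun y => θ (b y))
    (E₂ := Bundle.Trivial M ℝ) (ContMDiffAt.comp y (hθ (b y)) hb) hv
  exact (contMDiffAt_totalSpace.1 h1).2

/-- A family of tangent vectors at points `b y` which is smooth and such that `b` is locally the
identity is locally a smooth vector field. -/
theorem exists_field_eventually_mk_eq {b : M → M} {w : Π y : M, TangentSpace I (b y)} {x : M}
    [IsManifold I ∞ M]
    (hw : ContMDiffAt I I.tangent ∞ (fun y => (⟨b y, w y⟩ : TangentBundle I M)) x)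
    (hb : ∀ᶠ y in 𝓝 x, b y = y) :
    ∃ W : Π y : M, TangentSpace I y,
      ContMDiffAt I I.tangent ∞ (fun y => (⟨y, W y⟩ : TangentBundle I M)) x ∧
      ∀ᶠ y in 𝓝 x, (⟨y, W y⟩ : TangentBundle I M) = ⟨b y, w y⟩ := by
  classical
  have hmk : ∀ {y z : M} (h : y = z) (v : TangentSpace I y),
      (⟨z, h ▸ v⟩ : TangentBundle I M) = ⟨y, v⟩ := by
    rintro y _ rfl v; rfl
  -- Where `b y = y` the vector is transported; elsewhere the value 0 is arbitrary, as only the germ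
  -- at `x` matters.
  have h1 : ∀ᶠ y in 𝓝 x, (⟨y, if h : b y = y then h ▸ w y else 0⟩ : TangentBundle I M) =
      ⟨b y, w y⟩ := by
    filter_upwards [hb] with y hy
    rw [dif_pos hy]
    exact hmk hy (w y)
  exact ⟨_, hw.congr_of_eventuallyEq h1, h1⟩

theorem contMDiffAt_inner {V : Type*} [NormedAddCommGroup V] [InnerProductSpace ℝ V]
    {u v : M → V} {x : M} (hu : ContMDiffAt I 𝓘(ℝ, V) ∞ u x) (hv : ContMDiffAt I 𝓘(ℝ, V) ∞ v x) :
    ContMDiffAt I 𝓘(ℝ, ℝ) ∞ (fun y => (inner ℝ (u y) (v y) : ℝ)) x :=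
  ((contDiff_inner (𝕜 := ℝ) (E := V) (n := ∞)).contMDiff.contMDiffAt (x := (u x, v x))).comp x
    (hu.prodMk_space hv)

theorem contMDiffAt_neg_smul {u : M → HV n} {x : M} (q : ℍ[ℝ])
    (hu : ContMDiffAt I 𝓘(ℝ, HV n) ∞ u x) :
    ContMDiffAt I 𝓘(ℝ, HV n) ∞ (fun y => -(q • u y)) x := by
  have h : ContDiff ℝ ∞ fun v : HV n => -(q • v) := (contDiff_id.const_smul q).neg
  exact h.contMDiff.contMDiffAt.comp x hu

end General

/-! ### Smoothness of horizontal lifts. -/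

namespace InducedBundle

variable {f : C^∞⟮𝓡 m, B; 𝓘(ℝ, Fin n → ℍ[ℝ]), HP n⟯}

/-- The section of `P` through `p` that is constant in a local trivialization. -/
def constSection (a : Fin (n + 1)) (p : InducedBundle f) (b : B) : InducedBundle f :=
  (triv f a).symm (b, unitOf (p.toHV a))

theorem constSection_proj {a : Fin (n + 1)} {p : InducedBundle f} (hp : p.toHV a ≠ 0) :
    constSection a p p.proj = p := (triv f a).left_inv hp

variable [IsManifold (𝓡 m) ∞ B]

/-- Joint smoothness in the point and the base variable allows the section to vary with the point
through which it passes. -/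
theorem contMDiffAt_constSection {a : Fin (n + 1)} {q : InducedBundle f} (hq : q.toHV a ≠ 0) :
    ContMDiffAt ((PModel m).prod (𝓡 m)) (PModel m) ∞ (Function.uncurry (constSection (f := f) a))
      (q, q.proj) := by
  have hL : ContDiff ℝ ∞ fun v : HV n => v a := contDiff_piLp_apply 2
  have h1 : ContMDiff ((PModel m).prod (𝓡 m)) 𝓘(ℝ, ℍ[ℝ]) ∞
      (fun y : InducedBundle f × B => y.1.toHV a) :=
    hL.contMDiff.comp (contMDiff_toHV.comp contMDiff_fst)
  have h4 : ContMDiffAt ((PModel m).prod (𝓡 m)) (PModel m) ∞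
      (fun y : InducedBundle f × B => ((y.2, unitOf (y.1.toHV a)) : B × S3)) (q, q.proj) :=
    contMDiffAt_snd.prodMk (ContMDiffAt.comp (q, q.proj)
      (contMDiffOn_unitOf.contMDiffAt (isOpen_compl_singleton.mem_nhds hq)) h1.contMDiffAt)
  have hfq : f q.proj ∈ HP.dom a := (triv f a).map_source hq
  exact ContMDiffAt.comp (q, q.proj)
    ((contMDiffOn_triv_symm (f := f) a).contMDiffAt ((triv f a).open_target.mem_nhds hfq)) h4

theorem dproj_mfderiv_constSection {a : Fin (n + 1)} {q : InducedBundle f} (hq : q.toHV a ≠ 0)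
    (v : TangentSpace (𝓡 m) q.proj) :
    mfderiv (PModel m) (𝓡 m) proj (constSection a q q.proj)
      (mfderiv (𝓡 m) (PModel m) (constSection a q) q.proj v) = v := by
  have hd : MDifferentiableAt (𝓡 m) (PModel m) (constSection a q) q.proj := by
    have h1 : ContMDiffAt (𝓡 m) (PModel m) ∞ (constSection a q) q.proj :=
      ContMDiffAt.comp (f := fun b : B => (q, b)) q.proj (contMDiffAt_constSection hq)
        (contMDiffAt_const.prodMk contMDiffAt_id)
    exact h1.mdifferentiableAt (by simp)
  have h := mfderiv_comp_apply q.proj (mdifferentiable_proj (constSection a q q.proj)) hd v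
  have hid : proj ∘ constSection a q = id := rfl
  rw [hid, mfderiv_id] at h
  exact h.symm

/-- A smooth family of tangent vectors of `B` has a smooth, not necessarily horizontal, lift. -/
theorem exists_contMDiffAt_dproj_eq {p : InducedBundle f}
    (s : Π p : InducedBundle f, TangentSpace (𝓡 m) p.proj)
    (hs : ContMDiffAt (PModel m) (𝓡 m).tangent ∞
      (fun p : InducedBundle f => (⟨p.proj, s p⟩ : TangentBundle (𝓡 m) B)) p) :
    ∃ W : Π p : InducedBundle f, TangentSpace (PModel m) p,
      ContMDiffAt (PModel m) (PModel m).tangent ∞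
        (fun p => (⟨p, W p⟩ : TangentBundle (PModel m) (InducedBundle f))) p ∧
      ∀ᶠ q in 𝓝 p, dproj q (W q) = s q := by
  obtain ⟨a, ha⟩ := exists_mem_source p
  -- At each `q`, the section through `q` is differentiated at the projection of `q`, in the
  -- direction `s q`; as it is a section, the result projects back to `s q`.
  have h0 := contMDiffAt_mfderiv_family (constSection a) proj s (contMDiffAt_constSection ha) hs
  have hev : ∀ᶠ q : InducedBundle f in 𝓝 p, q.toHV a ≠ 0 := (triv f a).open_source.mem_nhds ha
  obtain ⟨W, hW, hWw⟩ := exists_field_eventually_mk_eq h0 (hev.mono fun q hq =>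
    constSection_proj hq)
  refine ⟨W, hW, ?_⟩
  filter_upwards [hev, hWw] with q hq hqw
  have h1 := congrArg (tangentMap (PModel m) (𝓡 m) proj) hqw
  have h2 : (⟨q.proj, dproj q (W q)⟩ : TangentBundle (𝓡 m) B) = ⟨q.proj, s q⟩ :=
    h1.trans (congrArg (Bundle.TotalSpace.mk q.proj) (dproj_mfderiv_constSection hq (s q)))
  exact Bundle.TotalSpace.mk_inj.1 h2

theorem contMDiffAt_connForm (i : Fin 3) {p : InducedBundle f}
    {W : Π p : InducedBundle f, TangentSpace (PModel m) p}
    (hW : ContMDiffAt (PModel m) (PModel m).tangent ∞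
      (fun p => (⟨p, W p⟩ : TangentBundle (PModel m) (InducedBundle f))) p) :
    ContMDiffAt (PModel m) 𝓘(ℝ, ℝ) ∞ (fun q => connForm i q (W q)) p := by
  have h1 : ContMDiffAt (PModel m) 𝓘(ℝ, HV n) ∞
      (fun q : InducedBundle f => mvfderiv (PModel m) toHV q (W q)) p :=
    contMDiffAt_mvfderiv_apply contMDiff_toHV.contMDiffAt hW
  exact contMDiffAt_inner (contMDiffAt_neg_smul (imUnit i) contMDiff_toHV.contMDiffAt) h1

theorem contMDiffAt_dproj {p : InducedBundle f}
    {W : Π p : InducedBundle f, TangentSpace (PModel m) p}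
    (hW : ContMDiffAt (PModel m) (PModel m).tangent ∞
      (fun p => (⟨p, W p⟩ : TangentBundle (PModel m) (InducedBundle f))) p) :
    ContMDiffAt (PModel m) (𝓡 m).tangent ∞
      (fun q : InducedBundle f => (⟨q.proj, dproj q (W q)⟩ : TangentBundle (𝓡 m) B)) p :=
  contMDiffAt_mfderiv_family (fun _ : InducedBundle f => proj) id W
    (contMDiff_proj.contMDiffAt.comp (p, p) contMDiffAt_snd) hW

/-- Tangent vectors of `P` are determined by their projections and the connection form. -/
theorem ext_dproj_connForm {p : InducedBundle f} {v w : TangentSpace (PModel m) p}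
    (h1 : dproj p v = dproj p w) (h2 : ∀ i, connForm i p v = connForm i p w) : v = w := by
  have h := (existsUnique_horizontalLift p 0).unique (y₁ := v - w) (y₂ := 0)
    ⟨by rw [map_sub, h1, sub_self], fun i => by rw [map_sub, h2, sub_self]⟩
    ⟨map_zero _, fun i => map_zero _⟩
  exact sub_eq_zero.1 h

theorem connForm_vert (i j : Fin 3) (p : InducedBundle f) :
    connForm j p (vert f i p) = if i = j then 1 else 0 :=
  connForm_vertical i j p _ (dtoHV_vert i p)

theorem eq_hlift_add_sum_vert (p : InducedBundle f) (v : TangentSpace (PModel m) p) :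
    v = hlift p (dproj p v) + ∑ i, connForm i p v • vert f i p := by
  refine ext_dproj_connForm ?_ fun j => ?_
  · simp [dproj_hlift, dproj_vert]
  · simp [connForm_hlift, connForm_vert]

/-- Any smooth lift becomes the horizontal one after subtracting its vertical part, which is smooth
because the connection components and the fields ξᵢ are. -/
theorem contMDiffAt_hlift {p : InducedBundle f}
    {s : Π p : InducedBundle f, TangentSpace (𝓡 m) p.proj}
    (hs : ContMDiffAt (PModel m) (𝓡 m).tangent ∞
      (fun p : InducedBundle f => (⟨p.proj, s p⟩ : TangentBundle (𝓡 m) B)) p) :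
    ContMDiffAt (PModel m) (PModel m).tangent ∞
      (fun p => (⟨p, hlift p (s p)⟩ : TangentBundle (PModel m) (InducedBundle f))) p := by
  obtain ⟨W, hW, hWs⟩ := exists_contMDiffAt_dproj_eq s hs
  have h1 := hW.sub_section (ContMDiffAt.sum_section (s := Finset.univ)
    fun i _ => (contMDiffAt_connForm i hW).smul_section (smoothField_vert (f := f) i p))
  refine h1.congr_of_eventuallyEq ?_
  filter_upwards [hWs] with q hq
  congr 1
  have h2 := eq_hlift_add_sum_vert q (W q)
  rw [hq] at h2
  exact eq_sub_of_add_eq h2.symm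

theorem smoothField_liftField {X : Π b : B, TangentSpace (𝓡 m) b} (hX : SmoothField (𝓡 m) X) :
    SmoothField (PModel m) (liftField f X) := fun p =>
  contMDiffAt_hlift (s := fun p => X p.proj) (ContMDiffAt.comp p hX.contMDiffAt
    contMDiff_proj.contMDiffAt)

end InducedBundle

/-! ### The almost complex structure: smoothness, components and square. -/

section Construction

open InducedBundle

variable [IsManifold (𝓡 m) ∞ B] (f : C^∞⟮𝓡 m, B; 𝓘(ℝ, Fin n → ℍ[ℝ]), HP n⟯)
  (S : SasakianStructure m B)

theorem smoothEnd_almostComplex : SmoothEnd (PModel m) (almostComplex f S) := by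
  refine smoothEnd_of_apply fun p W hW => ?_
  have hd := contMDiffAt_dproj hW
  have hφ : ContMDiffAt (PModel m) (𝓡 m).tangent ∞ (fun q : InducedBundle f =>
      (⟨q.proj, S.φ q.proj (dproj q (W q))⟩ : TangentBundle (𝓡 m) B)) p :=
    S.smooth_φ.contMDiffAt_apply contMDiff_proj.contMDiffAt hd
  have hη : ContMDiffAt (PModel m) 𝓘(ℝ, ℝ) ∞
      (fun q : InducedBundle f => S.η q.proj (dproj q (W q))) p :=
    S.smooth_η.contMDiffAt_apply contMDiff_proj.contMDiffAt hd
  have hξ : SmoothField (PModel m) (xiStar f S) := smoothField_liftField S.smooth_ξ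
  have h := ((((contMDiffAt_connForm 0 hW).smul_section (smoothField_vert (f := f) 1 p)).sub_section
    ((contMDiffAt_connForm 1 hW).smul_section (smoothField_vert (f := f) 0 p))).add_section
    ((contMDiffAt_connForm 2 hW).smul_section (hξ p))).sub_section
    (hη.smul_section (smoothField_vert (f := f) 2 p)) |>.add_section (contMDiffAt_hlift hφ)
  refine h.congr_of_eventuallyEq (Eventually.of_forall fun q => ?_)
  simp only [almostComplex_apply]
  rfl

/-- A vector of `P` is determined by its projection and its three connection components. This and
the next three lemmas describe `J` in these coordinates. -/
theorem dproj_almostComplex (p : InducedBundle f) (v : TangentSpace (PModel m) p) :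
    dproj p (almostComplex f S p v) = S.φ p.proj (dproj p v) + connForm 2 p v • S.ξ p.proj := by
  rw [almostComplex_apply]
  simp only [map_add, map_sub, map_smul, dproj_hlift, dproj_vert, xiStar, liftField, smul_zero, sub_zero,
    zero_add]
  rw [add_comm]

theorem connForm_zero_almostComplex (p : InducedBundle f) (v : TangentSpace (PModel m) p) :
    connForm 0 p (almostComplex f S p v) = -connForm 1 p v := by
  rw [almostComplex_apply]
  simp [connForm_hlift, connForm_vert, xiStar, liftField]

theorem connForm_one_almostComplex (p : InducedBundle f) (v : TangentSpace (PModel m) p) :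
    connForm 1 p (almostComplex f S p v) = connForm 0 p v := by
  rw [almostComplex_apply]
  simp [connForm_hlift, connForm_vert, xiStar, liftField]

theorem connForm_two_almostComplex (p : InducedBundle f) (v : TangentSpace (PModel m) p) :
    connForm 2 p (almostComplex f S p v) = -S.η p.proj (dproj p v) := by
  rw [almostComplex_apply]
  simp [connForm_hlift, connForm_vert, xiStar, liftField]

/-- Computing φ³v as φ²(φv) and as φ(φ²v), with φξ = 0, leaves η(φv)ξ = 0. -/
theorem eta_phi (b : B) (v : TangentSpace (𝓡 m) b) : S.η b (S.φ b v) = 0 := by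
  have h1 := S.φ_sq b (S.φ b v)
  have h2 := congrArg (S.φ b) (S.φ_sq b v)
  rw [map_add, map_neg, map_smul, phi_xi, smul_zero, add_zero] at h2
  rw [h2] at h1
  have h3 : S.η b (S.φ b v) • S.ξ b = 0 := by simpa using h1
  have h4 := congrArg (S.η b) h3
  simpa [S.η_ξ] using h4

theorem almostComplex_sq (p : InducedBundle f) (v : TangentSpace (PModel m) p) :
    almostComplex f S p (almostComplex f S p v) = -v := by
  refine ext_dproj_connForm ?_ fun i => ?_
  · simp [dproj_almostComplex, connForm_two_almostComplex, S.φ_sq, phi_xi]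
  · fin_cases i
    · simp [connForm_zero_almostComplex, connForm_one_almostComplex]
    · simp [connForm_zero_almostComplex, connForm_one_almostComplex]
    · simp [connForm_two_almostComplex, dproj_almostComplex, eta_phi, S.η_ξ]

end Construction

/-! ### Product rules and quaternionic adjoints for vector-valued functions. -/

section General

variable {E : Type*} [NormedAddCommGroup E] [NormedSpace ℝ E] {H : Type*} [TopologicalSpace H]
  {I : ModelWithCorners ℝ E H} {M : Type*} [TopologicalSpace M] [ChartedSpace H M]

theorem mvfderiv_inner_apply {V : Type*} [NormedAddCommGroup V] [InnerProductSpace ℝ V]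
    {u v : M → V} {x : M} (hu : MDifferentiableAt I 𝓘(ℝ, V) u x)
    (hv : MDifferentiableAt I 𝓘(ℝ, V) v x) (w : TangentSpace I x) :
    mvfderiv I (fun y => (inner ℝ (u y) (v y) : ℝ)) x w =
      inner ℝ (u x) (mvfderiv I v x w) + inner ℝ (mvfderiv I u x w) (v x) := by
  have h0 : HasMFDerivAt I 𝓘(ℝ, V × V) (fun y => (u y, v y)) x
      ((mfderiv I 𝓘(ℝ, V) u x).prod (mfderiv I 𝓘(ℝ, V) v x)) :=
    ⟨hu.continuousAt.prodMk hv.continuousAt, hu.hasMFDerivAt.2.prodMk hv.hasMFDerivAt.2⟩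
  have h1 := HasMFDerivAt.comp (f := fun y => (u y, v y))
    (g := fun z : V × V => (inner ℝ z.1 z.2 : ℝ)) x
    ((hasFDerivAt_fst (𝕜 := ℝ) (p := (u x, v x))).inner ℝ hasFDerivAt_snd).hasMFDerivAt h0
  exact DFunLike.congr_fun h1.mfderiv w

theorem mvfderiv_neg_smul_apply {u : M → HV n} {x : M} (q : ℍ[ℝ])
    (hu : MDifferentiableAt I 𝓘(ℝ, HV n) u x) (w : TangentSpace I x) :
    mvfderiv I (fun y => -(q • u y)) x w = -(q • mvfderiv I u x w) := by
  have h1 := HasMFDerivAt.comp (f := u) (g := fun v : HV n => -(q • v)) x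
    ((hasFDerivAt_id (𝕜 := ℝ) (u x)).const_smul q).neg.hasMFDerivAt hu.hasMFDerivAt
  exact DFunLike.congr_fun h1.mfderiv w

theorem smoothField_zero [IsManifold I ∞ M] :
    SmoothField I (fun x : M => (0 : TangentSpace I x)) :=
  contMDiff_zeroSection ℝ (TangentSpace I : M → Type _)

theorem nijenhuis_self (J : Π x : M, TangentSpace I x →L[ℝ] TangentSpace I x)
    (X : Π x : M, TangentSpace I x) (x : M) : nijenhuis I J X X x = 0 := by
  have h := nijenhuis_swap J X X x
  have h2 : (2 : ℝ) • nijenhuis I J X X x = 0 := by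
    rw [two_smul]
    nth_rewrite 1 [h]
    exact neg_add_cancel _
  exact (smul_eq_zero.1 h2).resolve_left two_ne_zero

/-- The inner product of `ℍ^(n+1)` is compatible with quaternionic conjugation. -/
theorem inner_quaternion_smul (q : ℍ[ℝ]) (v w : HV n) :
    (inner ℝ v (q • w) : ℝ) = inner ℝ (star q • v) w := by
  rw [PiLp.inner_apply, PiLp.inner_apply]
  refine Finset.sum_congr rfl fun i _ => ?_
  simp only [PiLp.smul_apply, smul_eq_mul, InducedBundle.inner_quaternion, Quaternion.re_mul,
    Quaternion.imI_mul, Quaternion.imJ_mul, Quaternion.imK_mul, Quaternion.re_star,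
    Quaternion.imI_star, Quaternion.imJ_star, Quaternion.imK_star]
  ring

end General

/-! ### Lie brackets of vertical fields and horizontal lifts. -/

namespace InducedBundle

variable {f : C^∞⟮𝓡 m, B; 𝓘(ℝ, Fin n → ℍ[ℝ]), HP n⟯} [IsManifold (𝓡 m) ∞ B]

theorem dproj_mlieBracket {V W : Π p : InducedBundle f, TangentSpace (PModel m) p}
    {X Y : Π b : B, TangentSpace (𝓡 m) b} (hV : SmoothField (PModel m) V)
    (hW : SmoothField (PModel m) W) (hX : SmoothField (𝓡 m) X) (hY : SmoothField (𝓡 m) Y)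
    (hVX : ∀ p, dproj p (V p) = X p.proj) (hWY : ∀ p, dproj p (W p) = Y p.proj)
    (p : InducedBundle f) :
    dproj p (mlieBracket (PModel m) V W p) = mlieBracket (𝓡 m) X Y p.proj :=
  mfderiv_mlieBracket_of_related p contMDiff_proj hV hW hX hY hVX hWY

theorem dproj_mlieBracket_liftField {X Y : Π b : B, TangentSpace (𝓡 m) b}
    (hX : SmoothField (𝓡 m) X) (hY : SmoothField (𝓡 m) Y) (p : InducedBundle f) :
    dproj p (mlieBracket (PModel m) (liftField f X) (liftField f Y) p) =
      mlieBracket (𝓡 m) X Y p.proj :=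
  dproj_mlieBracket (smoothField_liftField hX) (smoothField_liftField hY) hX hY
    (fun p => dproj_hlift p _) (fun p => dproj_hlift p _) p

/-- Together with the projection, the map to `HV n` is injective on tangent vectors, so brackets on
`P` can be computed by differentiating functions with values in a fixed vector space. -/
theorem dtoHV_mlieBracket {V W : Π p : InducedBundle f, TangentSpace (PModel m) p}
    (hV : SmoothField (PModel m) V) (hW : SmoothField (PModel m) W) (p : InducedBundle f) :
    dtoHV p (mlieBracket (PModel m) V W p) =
      mvfderiv (PModel m) (fun q : InducedBundle f => dtoHV q (W q)) p (V p)
        - mvfderiv (PModel m) (fun q : InducedBundle f => dtoHV q (V q)) p (W p) :=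
  mvfderiv_mlieBracket contMDiff_toHV.contMDiffAt hV.contMDiffAt hW.contMDiffAt

theorem mvfderiv_dtoHV_vert (i : Fin 3) (p : InducedBundle f) (w : TangentSpace (PModel m) p) :
    mvfderiv (PModel m) (fun q : InducedBundle f => dtoHV q (vert f i q)) p w =
      -(imUnit i • dtoHV p w) := by
  simp only [dtoHV_vert]
  exact mvfderiv_neg_smul_apply (imUnit i) (mdifferentiable_toHV p) w

/-- The derivative along ξᵢ of -eⱼ x is -eⱼ(-eᵢ x) = eⱼeᵢ x: the first field in the bracket
contributes the right-hand factor. -/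
theorem dtoHV_mlieBracket_vert (i j : Fin 3) (p : InducedBundle f) :
    dtoHV p (mlieBracket (PModel m) (vert f i) (vert f j) p) =
      (imUnit j * imUnit i - imUnit i * imUnit j) • p.toHV := by
  rw [dtoHV_mlieBracket (smoothField_vert i) (smoothField_vert j), mvfderiv_dtoHV_vert,
    mvfderiv_dtoHV_vert, dtoHV_vert, dtoHV_vert, smul_neg, smul_neg, neg_neg, neg_neg, smul_smul,
    smul_smul, sub_smul]

theorem dproj_mlieBracket_vert (i : Fin 3) {W : Π p : InducedBundle f, TangentSpace (PModel m) p}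
    {Y : Π b : B, TangentSpace (𝓡 m) b} (hW : SmoothField (PModel m) W)
    (hY : SmoothField (𝓡 m) Y) (hWY : ∀ p, dproj p (W p) = Y p.proj) (p : InducedBundle f) :
    dproj p (mlieBracket (PModel m) (vert f i) W p) = 0 := by
  rw [dproj_mlieBracket (smoothField_vert i) hW smoothField_zero hY (fun p => dproj_vert i p) hWY]
  exact congrFun mlieBracket_zero_left p.proj

theorem mlieBracket_vert_eq {i j k : Fin 3} {c : ℝ}
    (h : imUnit j * imUnit i - imUnit i * imUnit j = -(c • imUnit k)) (p : InducedBundle f) :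
    mlieBracket (PModel m) (vert f i) (vert f j) p = c • vert f k p := by
  refine sub_eq_zero.1 (eq_zero_of_dproj_dtoHV p _ ?_ ?_)
  · rw [map_sub, map_smul, dproj_mlieBracket_vert i (smoothField_vert j) smoothField_zero
      (fun p => dproj_vert j p), dproj_vert, smul_zero, sub_zero]
  · rw [map_sub, map_smul, dtoHV_mlieBracket_vert, dtoHV_vert, h, neg_smul, smul_neg, smul_assoc,
      sub_self]

theorem mlieBracket_vert_zero_two (p : InducedBundle f) :
    mlieBracket (PModel m) (vert f 0) (vert f 2) p = (-2 : ℝ) • vert f 1 p :=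
  mlieBracket_vert_eq (by
    ext
    all_goals
      simp only [Quaternion.re_sub, Quaternion.imI_sub, Quaternion.imJ_sub, Quaternion.imK_sub,
        Quaternion.re_mul, Quaternion.imI_mul, Quaternion.imJ_mul, Quaternion.imK_mul,
        Quaternion.re_neg, Quaternion.imI_neg, Quaternion.imJ_neg, Quaternion.imK_neg,
        Quaternion.re_smul, Quaternion.imI_smul, Quaternion.imJ_smul, Quaternion.imK_smul]
      simp [imUnit] <;> norm_num) p

theorem mlieBracket_vert_one_two (p : InducedBundle f) :
    mlieBracket (PModel m) (vert f 1) (vert f 2) p = (2 : ℝ) • vert f 0 p :=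
  mlieBracket_vert_eq (by
    ext
    all_goals
      simp only [Quaternion.re_sub, Quaternion.imI_sub, Quaternion.imJ_sub, Quaternion.imK_sub,
        Quaternion.re_mul, Quaternion.imI_mul, Quaternion.imJ_mul, Quaternion.imK_mul,
        Quaternion.re_neg, Quaternion.imI_neg, Quaternion.imJ_neg, Quaternion.imK_neg,
        Quaternion.re_smul, Quaternion.imI_smul, Quaternion.imJ_smul, Quaternion.imK_smul]
      simp [imUnit] <;> norm_num) p

/-- Horizontal vectors are orthogonal to the quaternionic line through the base point. -/
theorem inner_smul_toHV_dtoHV {p : InducedBundle f} {w : TangentSpace (PModel m) p}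
    (hw : ∀ i, connForm i p w = 0) (q : ℍ[ℝ]) : (inner ℝ (q • p.toHV) (dtoHV p w) : ℝ) = 0 := by
  have h0 : (inner ℝ p.toHV (dtoHV p w) : ℝ) = 0 := by
    rw [real_inner_comm]; exact inner_dtoHV_toHV p w
  have hi : ∀ i, (inner ℝ (imUnit i • p.toHV) (dtoHV p w) : ℝ) = 0 := fun i => by
    have h : (inner ℝ (-(imUnit i • p.toHV)) (dtoHV p w) : ℝ) = 0 := hw i
    rwa [inner_neg_left, neg_eq_zero] at h
  have hq : q = q.re • (1 : ℍ[ℝ]) + q.imI • imUnit 0 + q.imJ • imUnit 1 + q.imK • imUnit 2 := by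
    ext
    all_goals
      simp only [Quaternion.re_smul, Quaternion.imI_smul, Quaternion.imJ_smul,
        Quaternion.imK_smul, Quaternion.re_add, Quaternion.imI_add, Quaternion.imJ_add,
        Quaternion.imK_add, Quaternion.re_one, Quaternion.imI_one, Quaternion.imJ_one,
        Quaternion.imK_one]
      simp [imUnit]
  rw [hq]
  simp only [add_smul, smul_assoc, one_smul, inner_add_left, real_inner_smul_left, h0, hi,
    mul_zero, add_zero]

/-- Left multiplication by unit quaternions preserves fibres and horizontal spaces, hence `X^*`, and
the ξᵢ generate it. The proof is infinitesimal: the projection vanishes because ξᵢ is related to the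
zero field, and the connection components vanish by differentiating the orthogonality of `X^*` to
the orbit. -/
theorem mlieBracket_vert_liftField (i : Fin 3) {X : Π b : B, TangentSpace (𝓡 m) b}
    (hX : SmoothField (𝓡 m) X) (p : InducedBundle f) :
    mlieBracket (PModel m) (vert f i) (liftField f X) p = 0 := by
  have hXs := smoothField_liftField (f := f) hX
  have hhor : ∀ (q : InducedBundle f) j, connForm j q (liftField f X q) = 0 := fun q j =>
    connForm_hlift j q _
  refine ext_dproj_connForm ?_ fun k => ?_
  · rw [map_zero, dproj_mlieBracket_vert i hXs hX (fun p => dproj_hlift p _)]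
  · rw [map_zero]
    have hd : MDifferentiableAt (PModel m) 𝓘(ℝ, HV n)
        (fun q : InducedBundle f => dtoHV q (liftField f X q)) p :=
      (contMDiffAt_mvfderiv_apply contMDiff_toHV.contMDiffAt
        hXs.contMDiffAt).mdifferentiableAt (by simp)
    have hn : MDifferentiableAt (PModel m) 𝓘(ℝ, HV n)
        (fun q : InducedBundle f => -(imUnit k • q.toHV)) p :=
      (contMDiffAt_neg_smul (imUnit k) contMDiff_toHV.contMDiffAt).mdifferentiableAt (by simp)
    have h1 := mvfderiv_inner_apply hn hd (vert f i p)
    have h2 : (fun q : InducedBundle f =>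
        (inner ℝ (-(imUnit k • q.toHV)) (dtoHV q (liftField f X q)) : ℝ)) = fun _ => 0 :=
      funext fun q => hhor q k
    rw [h2, mvfderiv_const, mvfderiv_neg_smul_apply (imUnit k) (mdifferentiable_toHV p)] at h1
    change 0 = _ + inner ℝ (-(imUnit k • dtoHV p (vert f i p))) _ at h1
    -- The derivative of -eₖ x along ξᵢ is eₖeᵢ x, which stays in the quaternionic line of `x`, to
    -- which `X^*` is orthogonal.
    rw [dtoHV_vert, smul_neg, neg_neg, smul_smul, inner_smul_toHV_dtoHV (hhor p), add_zero] at h1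
    change inner ℝ (-(imUnit k • p.toHV)) (dtoHV p _) = (0 : ℝ)
    -- The other half of the commutator is eᵢ applied to the image of `X^*`; moving eᵢ to the other
    -- factor as its conjugate again gives a vector of the quaternionic line.
    rw [dtoHV_mlieBracket (smoothField_vert i) hXs, mvfderiv_dtoHV_vert, inner_sub_right, ← h1,
      inner_neg_right, inner_neg_left, inner_quaternion_smul, smul_smul,
      inner_smul_toHV_dtoHV (hhor p)]
    simp

end InducedBundle

/-! ### Bracket identities on the Sasakian base. -/

section Sasakian

variable [IsManifold (𝓡 m) ∞ B] (S : SasakianStructure m B)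

/-- When η takes constant values on both fields, the two derivative terms of dη vanish and the
contact condition computes η of the bracket. -/
theorem eta_mlieBracket {X Y : Π b : B, TangentSpace (𝓡 m) b} (hX : SmoothField (𝓡 m) X)
    (hY : SmoothField (𝓡 m) Y) {c d : ℝ} (hXη : ∀ b, S.η b (X b) = c)
    (hYη : ∀ b, S.η b (Y b) = d) (b : B) :
    S.η b (mlieBracket (𝓡 m) X Y b) = -(2 * S.g.inner b (X b) (S.φ b (Y b))) := by
  have h := S.contact X Y hX hY b
  simp only [dForm, hXη, hYη, mvfderiv_const, zero_apply] at h
  linarith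

theorem eta_mlieBracket_xi {X : Π b : B, TangentSpace (𝓡 m) b} (hX : SmoothField (𝓡 m) X)
    (hXη : ∀ b, S.η b (X b) = 0) (b : B) : S.η b (mlieBracket (𝓡 m) S.ξ X b) = 0 := by
  rw [eta_mlieBracket S S.smooth_ξ hX S.η_ξ hXη, S.g.symm, ← eta_eq, eta_phi, mul_zero, neg_zero]

theorem dForm_eta {X Y : Π b : B, TangentSpace (𝓡 m) b} {c d : ℝ} (hXη : ∀ b, S.η b (X b) = c)
    (hYη : ∀ b, S.η b (Y b) = d) (b : B) :
    dForm (𝓡 m) S.η X Y b = -S.η b (mlieBracket (𝓡 m) X Y b) := by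
  simp only [dForm, hXη, hYη, mvfderiv_const, zero_apply]
  ring

/-- On the kernel of η the flow of ξ preserves φ. Normality with first argument ξ only gives this
after applying φ; one more φ removes it, since φ² = -1 on vectors killed by η. -/
theorem phi_mlieBracket_xi {X : Π b : B, TangentSpace (𝓡 m) b} (hX : SmoothField (𝓡 m) X)
    (hXη : ∀ b, S.η b (X b) = 0) (b : B) :
    S.φ b (mlieBracket (𝓡 m) S.ξ X b) = mlieBracket (𝓡 m) S.ξ (fun c => S.φ c (X c)) b := by
  have hφX := S.smooth_φ.apply hX
  have h := S.normal S.ξ X S.smooth_ξ hX b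
  have h0 : (fun c => S.φ c (S.ξ c)) = 0 := funext fun c => phi_xi S c
  rw [h0, mlieBracket_zero_left, mlieBracket_zero_left, dForm_eta S S.η_ξ hXη,
    eta_mlieBracket_xi S hX hXη] at h
  simp only [Pi.zero_apply, map_zero, add_zero, sub_zero, neg_zero, zero_smul] at h
  rw [← map_sub] at h
  have h1 := congrArg (S.φ b) h
  rw [S.φ_sq, map_zero, map_sub, eta_phi,
    eta_mlieBracket_xi S hφX (fun c => eta_phi S c _), sub_zero, zero_smul, add_zero,
    neg_eq_zero] at h1
  exact sub_eq_zero.1 h1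

theorem phi_phi {b : B} {v : TangentSpace (𝓡 m) b} (hv : S.η b v = 0) : S.φ b (S.φ b v) = -v := by
  rw [S.φ_sq, hv, zero_smul, add_zero]

/-- On the kernel of η, the ξ-component of φ²[X, Y] cancels the term dη(X, Y)ξ of the normality
condition. What remains has the shape of a Nijenhuis tensor of φ. -/
theorem mlieBracket_phi_phi {X Y : Π b : B, TangentSpace (𝓡 m) b} (hX : SmoothField (𝓡 m) X)
    (hY : SmoothField (𝓡 m) Y) (hXη : ∀ b, S.η b (X b) = 0) (hYη : ∀ b, S.η b (Y b) = 0) (b : B) :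
    mlieBracket (𝓡 m) X Y b
      + S.φ b (mlieBracket (𝓡 m) (fun c => S.φ c (X c)) Y b)
      + S.φ b (mlieBracket (𝓡 m) X (fun c => S.φ c (Y c)) b)
      - mlieBracket (𝓡 m) (fun c => S.φ c (X c)) (fun c => S.φ c (Y c)) b = 0 := by
  have h := S.normal X Y hX hY b
  rw [S.φ_sq, dForm_eta S hXη hYη, neg_smul] at h
  rw [← neg_eq_zero, ← h]
  abel

/-- By the contact condition the sum is -2g(φX, φY) - 2g(X, φ²Y). Compatibility and φ²Y = -Y make
the two terms cancel. -/
theorem eta_mlieBracket_phi_add {X Y : Π b : B, TangentSpace (𝓡 m) b} (hX : SmoothField (𝓡 m) X)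
    (hY : SmoothField (𝓡 m) Y) (hXη : ∀ b, S.η b (X b) = 0) (hYη : ∀ b, S.η b (Y b) = 0) (b : B) :
    S.η b (mlieBracket (𝓡 m) (fun c => S.φ c (X c)) Y b)
      + S.η b (mlieBracket (𝓡 m) X (fun c => S.φ c (Y c)) b) = 0 := by
  rw [eta_mlieBracket S (S.smooth_φ.apply hX) hY (fun c => eta_phi S c _) hYη,
    eta_mlieBracket S hX (S.smooth_φ.apply hY) hXη (fun c => eta_phi S c _), S.compatible,
    phi_phi S (hYη b), map_neg, hXη b]
  ring

end Sasakian

/-! ### Vanishing of the Nijenhuis tensor on complex generators. -/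

section Integrability

open InducedBundle

variable [IsManifold (𝓡 m) ∞ B] {f : C^∞⟮𝓡 m, B; 𝓘(ℝ, Fin n → ℍ[ℝ]), HP n⟯} {S : SasakianStructure m B}

/-- The forms vanish on horizontal lifts, so only the bracket term of the exterior derivative
survives. This turns conditions 2 and 3 into statements about vertical parts of brackets. -/
theorem connForm_mlieBracket_liftField (S : SasakianStructure m B) (i : Fin 3)
    (X Y : Π b : B, TangentSpace (𝓡 m) b) (p : InducedBundle f) :
    connForm i p (mlieBracket (PModel m) (liftField f X) (liftField f Y) p) =
      -dForm (PModel m) (etaHat f S i) (liftField f X) (liftField f Y) p := by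
  simp [dForm, etaHat_eq, liftField, connForm_hlift, mvfderiv_const]

theorem almostComplex_liftField {X : Π b : B, TangentSpace (𝓡 m) b}
    (hX : ∀ b, S.η b (X b) = 0) :
    (fun p => almostComplex f S p (liftField f X p)) = liftField f fun b => S.φ b (X b) :=
  funext fun p => almostComplex_hlift f S p _ (by rw [← eta_eq, hX])

/-- The terms with ξ^* drop out, and [ξ₁, ξ₃] = -2ξ₂ cancels J[ξ₂, ξ₃] = 2Jξ₁ = 2ξ₂. -/
theorem nijenhuis_vert_zero_two (p : InducedBundle f) :
    nijenhuis (PModel m) (almostComplex f S) (vert f 0) (vert f 2) p = 0 := by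
  simp only [nijenhuis, almostComplex_vert_zero, almostComplex_vert_two]
  rw [mlieBracket_vert_zero_two, mlieBracket_vert_one_two]
  have h : ∀ i, mlieBracket (PModel m) (vert f i) (fun y => xiStar f S y) p = 0 := fun i =>
    mlieBracket_vert_liftField i S.smooth_ξ p
  rw [h, h, map_smul, almostComplex_vert_zero, map_zero, neg_smul]
  simp

theorem nijenhuis_vert_zero_liftField {X : Π b : B, TangentSpace (𝓡 m) b}
    (hX : SmoothField (𝓡 m) X) (hXη : ∀ b, S.η b (X b) = 0) (p : InducedBundle f) :
    nijenhuis (PModel m) (almostComplex f S) (vert f 0) (liftField f X) p = 0 := by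
  simp only [nijenhuis, almostComplex_vert_zero]
  rw [almostComplex_liftField hXη, mlieBracket_vert_liftField _ hX,
    mlieBracket_vert_liftField _ (S.smooth_φ.apply hX)]
  have h1 : mlieBracket (PModel m) (fun y => vert f 1 y) (liftField f X) p = 0 :=
    mlieBracket_vert_liftField 1 hX p
  have h2 : mlieBracket (PModel m) (fun y => vert f 1 y)
      (liftField f fun b => S.φ b (X b)) p = 0 :=
    mlieBracket_vert_liftField 1 (S.smooth_φ.apply hX) p
  rw [h1, h2]
  simp

theorem nijenhuis_vert_two_liftField
    (h₂ : ∀ (i : Fin 3) (X : Π b : B, TangentSpace (𝓡 m) b),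
      SmoothField (𝓡 m) X → (∀ b, S.g.inner b (X b) (S.ξ b) = 0) →
      ∀ p : InducedBundle f,
        dForm (PModel m) (etaHat f S i) (liftField f X) (xiStar f S) p = 0)
    {X : Π b : B, TangentSpace (𝓡 m) b}
    (hX : SmoothField (𝓡 m) X) (hXη : ∀ b, S.η b (X b) = 0) (p : InducedBundle f) :
    nijenhuis (PModel m) (almostComplex f S) (vert f 2) (liftField f X) p = 0 := by
  have hφX := S.smooth_φ.apply hX
  -- Condition 2 says that [ξ^*, Z^*] is horizontal; it is applied below both to `X` and to φX.
  have hc : ∀ (i : Fin 3) (Z : Π b : B, TangentSpace (𝓡 m) b), SmoothField (𝓡 m) Z →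
      (∀ b, S.η b (Z b) = 0) →
      connForm i p (mlieBracket (PModel m) (liftField f S.ξ) (liftField f Z) p) = 0 := by
    intro i Z hZ hZη
    rw [mlieBracket_swap_apply, map_neg, connForm_mlieBracket_liftField S]
    have h := h₂ i Z hZ (fun b => by rw [← eta_eq, hZη]) p
    rw [xiStar] at h
    rw [h, neg_zero, neg_zero]
  have hJ : (fun p => almostComplex f S p (vert f 2 p)) = liftField f S.ξ :=
    funext fun p => almostComplex_vert_two f S p
  simp only [nijenhuis]
  rw [hJ, almostComplex_liftField hXη, mlieBracket_vert_liftField _ hX,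
    mlieBracket_vert_liftField _ hφX, map_zero, zero_add, add_zero, sub_eq_zero]
  have hd : dproj p (mlieBracket (PModel m) (liftField f S.ξ) (liftField f X) p) =
      mlieBracket (𝓡 m) S.ξ X p.proj := dproj_mlieBracket_liftField S.smooth_ξ hX p
  refine ext_dproj_connForm ?_ fun i => ?_
  · rw [dproj_almostComplex, hd, hc 2 X hX hXη, zero_smul, add_zero,
      dproj_mlieBracket_liftField S.smooth_ξ hφX, phi_mlieBracket_xi S hX hXη]
  · rw [hc i _ hφX (fun b => eta_phi S b _)]
    fin_cases i
    · exact (connForm_zero_almostComplex f S p _).trans (by rw [hc 1 X hX hXη, neg_zero])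
    · exact (connForm_one_almostComplex f S p _).trans (hc 0 X hX hXη)
    · exact (connForm_two_almostComplex f S p _).trans
        (by rw [hd, eta_mlieBracket_xi S hX hXη, neg_zero])

theorem nijenhuis_liftField_liftField
    (h₃ : ∀ (i : Fin 3) (X Y : Π b : B, TangentSpace (𝓡 m) b),
      SmoothField (𝓡 m) X → SmoothField (𝓡 m) Y →
      (∀ b, S.g.inner b (X b) (S.ξ b) = 0) → (∀ b, S.g.inner b (Y b) (S.ξ b) = 0) →
      ∀ p : InducedBundle f,
        dForm (PModel m) (etaHat f S i)
          (liftField f fun b => S.φ b (X b)) (liftField f fun b => S.φ b (Y b)) p =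
        dForm (PModel m) (etaHat f S i) (liftField f X) (liftField f Y) p)
    {X Y : Π b : B, TangentSpace (𝓡 m) b}
    (hX : SmoothField (𝓡 m) X) (hY : SmoothField (𝓡 m) Y) (hXη : ∀ b, S.η b (X b) = 0)
    (hYη : ∀ b, S.η b (Y b) = 0) (p : InducedBundle f) :
    nijenhuis (PModel m) (almostComplex f S) (liftField f X) (liftField f Y) p = 0 := by
  have hφX := S.smooth_φ.apply hX
  have hφY := S.smooth_φ.apply hY
  have hc : ∀ (i : Fin 3) (Z W : Π b : B, TangentSpace (𝓡 m) b), SmoothField (𝓡 m) Z →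
      SmoothField (𝓡 m) W → (∀ b, S.η b (Z b) = 0) → (∀ b, S.η b (W b) = 0) →
      connForm i p (mlieBracket (PModel m) (liftField f fun b => S.φ b (Z b))
        (liftField f fun b => S.φ b (W b)) p) =
      connForm i p (mlieBracket (PModel m) (liftField f Z) (liftField f W) p) := by
    intro i Z W hZ hW hZη hWη
    rw [connForm_mlieBracket_liftField S, connForm_mlieBracket_liftField S,
      h₃ i Z W hZ hW (fun b => by rw [← eta_eq, hZη]) (fun b => by rw [← eta_eq, hWη])]
  have hφφ : (liftField f fun b => S.φ b (S.φ b (X b))) = (-1 : ℝ) • liftField f X := by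
    funext q
    simp only [liftField, phi_phi S (hXη _), Pi.smul_apply, map_neg, neg_smul, one_smul]
  have hXd : MDifferentiableAt (PModel m) (PModel m).tangent
      (fun q => (⟨q, liftField f X q⟩ : TangentBundle (PModel m) (InducedBundle f))) p :=
    (smoothField_liftField hX p).mdifferentiableAt (by simp)
  -- Condition 3 for the pair φX, Y: since φ²X = -X, the curvature is skew under moving φ from one
  -- argument to the other.
  have hanti : ∀ i, connForm i p (mlieBracket (PModel m) (liftField f fun b => S.φ b (X b))
        (liftField f Y) p) +
      connForm i p (mlieBracket (PModel m) (liftField f X)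
        (liftField f fun b => S.φ b (Y b)) p) = 0 := by
    intro i
    have h := hc i _ Y hφX hY (fun b => eta_phi S b _) hYη
    rw [hφφ, mlieBracket_const_smul_left hXd, map_smul, neg_smul, one_smul] at h
    rw [← h, neg_add_cancel]
  have hd : ∀ (Z W : Π b : B, TangentSpace (𝓡 m) b), SmoothField (𝓡 m) Z →
      SmoothField (𝓡 m) W → dproj p (mlieBracket (PModel m) (liftField f Z) (liftField f W) p) =
      mlieBracket (𝓡 m) Z W p.proj := fun Z W hZ hW => dproj_mlieBracket_liftField hZ hW p
  simp only [nijenhuis]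
  rw [almostComplex_liftField hXη, almostComplex_liftField hYη]
  refine ext_dproj_connForm ?_ fun i => ?_
  -- The third connection component matters in the projection because `J` sends ξ₃ to ξ^*: the two
  -- resulting multiples of ξ cancel, and the rest is the normality identity.
  · have h2 := hanti 2
    rw [map_zero, map_sub, map_add, map_add, dproj_almostComplex, dproj_almostComplex,
      hd X Y hX hY, hd _ Y hφX hY, hd X _ hX hφY, hd _ _ hφX hφY,
      ← mlieBracket_phi_phi S hX hY hXη hYη p.proj, eq_neg_of_add_eq_zero_left h2, neg_smul]
    abel
  · rw [map_zero, map_sub, map_add, map_add, hc i X Y hX hY hXη hYη]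
    -- `J` exchanges the first two vertical components up to sign, so those cases follow from
    -- skewness of the curvature. The third component of `J` is -η of the projection, which is a
    -- Sasakian identity.
    have hi : connForm i p (almostComplex f S p (mlieBracket (PModel m)
          (liftField f fun b => S.φ b (X b)) (liftField f Y) p)) +
        connForm i p (almostComplex f S p (mlieBracket (PModel m) (liftField f X)
          (liftField f fun b => S.φ b (Y b)) p)) = 0 := by
      fin_cases i
      · exact (congrArg₂ _ (connForm_zero_almostComplex f S p _)
          (connForm_zero_almostComplex f S p _)).trans (by rw [← neg_add, hanti, neg_zero])
      · exact (congrArg₂ _ (connForm_one_almostComplex f S p _)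
          (connForm_one_almostComplex f S p _)).trans (hanti 0)
      · exact (congrArg₂ _ (connForm_two_almostComplex f S p _)
          (connForm_two_almostComplex f S p _)).trans (by
            rw [hd _ Y hφX hY, hd X _ hX hφY, ← neg_add,
              eta_mlieBracket_phi_add S hX hY hXη hYη, neg_zero])
    linarith

variable (f S) in
/-- The fields `ξ₁`, `ξ₃` and the horizontal lifts of the fields orthogonal to `ξ`. -/
def complexGenerators : Set (Π p : InducedBundle f, TangentSpace (PModel m) p) :=
  {vert f 0, vert f 2} ∪
    {W | ∃ X : Π b : B, TangentSpace (𝓡 m) b, SmoothField (𝓡 m) X ∧ (∀ b, S.η b (X b) = 0) ∧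
      liftField f X = W}

/-- Subtracting η(X)ξ from any smooth extension makes it lie in the kernel of η everywhere, without
changing its value at `b`. -/
theorem exists_smoothField_eta_eq_zero [T2Space B] {b : B} {v : TangentSpace (𝓡 m) b}
    (hv : S.η b v = 0) : ∃ X : Π b : B, TangentSpace (𝓡 m) b,
      SmoothField (𝓡 m) X ∧ (∀ b, S.η b (X b) = 0) ∧ X b = v := by
  obtain ⟨X, hX, rfl⟩ := exists_smoothField_eq b v
  refine ⟨fun c => X c - S.η c (X c) • S.ξ c, fun c => ?_, fun c => ?_, ?_⟩
  · exact (hX c).sub_section ((S.smooth_η.contMDiffAt_apply (b := id) contMDiffAt_id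
      (hX c)).smul_section (S.smooth_ξ c))
  · simp [S.η_ξ]
  · simp [hv]

theorem span_complexGenerators [T2Space B] (p : InducedBundle f) :
    Submodule.span ℝ ((fun X => X p) '' complexGenerators f S ∪
      (fun X => almostComplex f S p (X p)) '' complexGenerators f S) = ⊤ := by
  rw [eq_top_iff]
  intro v _
  set G := (fun X => X p) '' complexGenerators f S ∪
      (fun X => almostComplex f S p (X p)) '' complexGenerators f S
  have h0 : vert f 0 p ∈ Submodule.span ℝ G :=
    Submodule.subset_span (.inl ⟨_, .inl (.inl rfl), rfl⟩)
  have h1 : vert f 1 p ∈ Submodule.span ℝ G :=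
    Submodule.subset_span (.inr ⟨_, .inl (.inl rfl), almostComplex_vert_zero f S p⟩)
  have h2 : vert f 2 p ∈ Submodule.span ℝ G :=
    Submodule.subset_span (.inl ⟨_, .inl (.inr rfl), rfl⟩)
  have h3 : hlift p (S.ξ p.proj) ∈ Submodule.span ℝ G :=
    Submodule.subset_span (.inr ⟨_, .inl (.inr rfl), almostComplex_vert_two f S p⟩)
  have h4 : ∀ w : TangentSpace (𝓡 m) p.proj, S.η p.proj w = 0 →
      hlift p w ∈ Submodule.span ℝ G := by
    intro w hw
    obtain ⟨X, hX, hXη, rfl⟩ := exists_smoothField_eta_eq_zero hw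
    exact Submodule.subset_span (.inl ⟨_, .inr ⟨X, hX, hXη, rfl⟩, rfl⟩)
  -- The horizontal part of `v` is split into the lift of a vector killed by η and a multiple of ξ^*
  -- = Jξ₃.
  have h5 := h4 (dproj p v - S.η p.proj (dproj p v) • S.ξ p.proj) (by simp [S.η_ξ])
  have h6 := Submodule.add_mem _ h5 (Submodule.smul_mem _ (S.η p.proj (dproj p v)) h3)
  rw [← map_smul, ← map_add, sub_add_cancel] at h6
  rw [eq_hlift_add_sum_vert p v, Fin.sum_univ_three]
  exact Submodule.add_mem _ h6 (Submodule.add_mem _ (Submodule.add_mem _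
    (Submodule.smul_mem _ _ h0) (Submodule.smul_mem _ _ h1)) (Submodule.smul_mem _ _ h2))

theorem smoothField_of_mem_complexGenerators
    (W : Π p : InducedBundle f, TangentSpace (PModel m) p) (hW : W ∈ complexGenerators f S) :
    SmoothField (PModel m) W := by
  rcases hW with (rfl | rfl) | ⟨X, hX, -, rfl⟩
  · exact smoothField_vert 0
  · exact smoothField_vert 2
  · exact smoothField_liftField hX

theorem nijenhuis_complexGenerators
    (h₂ : ∀ (i : Fin 3) (X : Π b : B, TangentSpace (𝓡 m) b),
      SmoothField (𝓡 m) X → (∀ b, S.g.inner b (X b) (S.ξ b) = 0) →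
      ∀ p : InducedBundle f,
        dForm (PModel m) (etaHat f S i) (liftField f X) (xiStar f S) p = 0)
    (h₃ : ∀ (i : Fin 3) (X Y : Π b : B, TangentSpace (𝓡 m) b),
      SmoothField (𝓡 m) X → SmoothField (𝓡 m) Y →
      (∀ b, S.g.inner b (X b) (S.ξ b) = 0) → (∀ b, S.g.inner b (Y b) (S.ξ b) = 0) →
      ∀ p : InducedBundle f,
        dForm (PModel m) (etaHat f S i)
          (liftField f fun b => S.φ b (X b)) (liftField f fun b => S.φ b (Y b)) p =
        dForm (PModel m) (etaHat f S i) (liftField f X) (liftField f Y) p)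
    {V W : Π p : InducedBundle f, TangentSpace (PModel m) p} (hV : V ∈ complexGenerators f S)
    (hW : W ∈ complexGenerators f S) (p : InducedBundle f) :
    nijenhuis (PModel m) (almostComplex f S) V W p = 0 := by
  rcases hV with (rfl | rfl) | ⟨X, hX, hXη, rfl⟩ <;>
    rcases hW with (rfl | rfl) | ⟨Y, hY, hYη, rfl⟩
  · exact nijenhuis_self _ _ p
  · exact nijenhuis_vert_zero_two p
  · exact nijenhuis_vert_zero_liftField hY hYη p
  · rw [nijenhuis_swap, nijenhuis_vert_zero_two, neg_zero]
  · exact nijenhuis_self _ _ p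
  · exact nijenhuis_vert_two_liftField h₂ hY hYη p
  · rw [nijenhuis_swap, nijenhuis_vert_zero_liftField hX hXη, neg_zero]
  · rw [nijenhuis_swap, nijenhuis_vert_two_liftField h₂ hX hXη, neg_zero]
  · exact nijenhuis_liftField_liftField h₃ hX hY hXη hYη p

end Integrability

end HopfSasaki

end

theorem mainTheorem4 {m n : ℕ} {B : Type*} [TopologicalSpace B] [T2Space B] [CompactSpace B]
    [ChartedSpace (EuclideanSpace ℝ (Fin m)) B] [IsManifold (𝓡 m) ∞ B]
    (f : C^∞⟮𝓡 m, B; 𝓘(ℝ, Fin n → ℍ[ℝ]), HP n⟯)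
    (hf : Manifold.IsSmoothEmbedding (𝓡 m) 𝓘(ℝ, Fin n → ℍ[ℝ]) ∞ f)
    (S : SasakianStructure m B)
    (h₁ : ∀ (i k : Fin 3) (p : InducedBundle f),
      dForm (PModel m) (etaHat f S k)
        (InducedBundle.vert f i) (xiStar f S) p = 0)
    (h₂ : ∀ (i : Fin 3) (X : Π b : B, TangentSpace (𝓡 m) b),
      SmoothField (𝓡 m) X → (∀ b, S.g.inner b (X b) (S.ξ b) = 0) →
      ∀ p : InducedBundle f,
        dForm (PModel m) (etaHat f S i)
          (InducedBundle.liftField f X) (xiStar f S) p = 0)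
    (h₃ : ∀ (i : Fin 3) (X Y : Π b : B, TangentSpace (𝓡 m) b),
      SmoothField (𝓡 m) X → SmoothField (𝓡 m) Y →
      (∀ b, S.g.inner b (X b) (S.ξ b) = 0) → (∀ b, S.g.inner b (Y b) (S.ξ b) = 0) →
      ∀ p : InducedBundle f,
        dForm (PModel m) (etaHat f S i)
          (InducedBundle.liftField f fun b => S.φ b (X b))
          (InducedBundle.liftField f fun b => S.φ b (Y b)) p =
        dForm (PModel m) (etaHat f S i)
          (InducedBundle.liftField f X) (InducedBundle.liftField f Y) p) :
    IsIntegrable (PModel m) (almostComplex f S) := by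
  refine ⟨smoothEnd_almostComplex f S, almostComplex_sq f S, fun X Y hX hY p =>
    nijenhuis_eq_zero_of_generators (smoothEnd_almostComplex f S) (almostComplex_sq f S) p
      (complexGenerators f S) smoothField_of_mem_complexGenerators (span_complexGenerators p)
      (fun V hV W hW => nijenhuis_complexGenerators h₂ h₃ hV hW p) hX hY⟩
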